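/- Let $G=(V,E)$ be a finite simple graph and let $\chi:V\to\mathcal C\cup\{\bullet\}$ be a colouring of its vertices, where $\mathcal C$ is a finite set of colours and $\chi(v)=\bullet$ means that $v$ is uncoloured. For $X\subseteq V$ let $k(X)$ be the number of colours of $\mathcal C$ that occur in $X$, and assume that $k=k(V)\le 2$. Let $r:\mathcal C\to\mathbb R_{>0}$ and put $r(\bullet)=1$. A framework $(G,\chi,p)$ on $r\mathbb S^2$ is given by a map $p:V\to\mathbb R^3$ with $\|p(v)\|=r(\chi(v))$ for all $v\in V$. It is generic if every polynomial with rational coefficients, in variables for the coordinates of all $p(v)$ and for the radii $r(c)$, $c\in\mathcal C$, that vanishes at $(p,r)$ belongs to the ideal generated by the polynomials $\sum_{i=1}^{3}x_{v,i}^2-t_{\chi(v)}^2$ ($v\in V$), where $t_\bullet=1$. The rigidity matrix $R(G,\chi,p)$ has rows indexed by $E\sqcup V$ and columns indexed by the $3|V|$ coordinates of the vertices and by $\mathcal C$. The row of an edge $uw$ has $p(u)-p(w)$ in the columns of $u$, $p(w)-p(u)$ in the columns of $w$, and zeros elsewhere. The row of a vertex $v$ has $p(v)$ in the columns of $v$,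 a $1$ in the column $\chi(v)$ if $v$ is coloured, and zeros elsewhere. A cover of $G$ is a family $\mathcal X$ of subsets of $V$ with at least two elements each such that both ends of every edge of $G$ lie in a common member of $\mathcal X$. It is 1-thin if any two distinct members share at most one vertex, and, for $X\subseteq V$, it is $X$-restricted if every $X_i\in\mathcal X$ with $|X_i|\ge 3$ satisfies $X_i\subseteq X$. Theorem. If $(G,\chi,p)$ is a generic framework on $r\mathbb S^2$ with $k\le 2$, then $$\operatorname{rank} R(G,\chi,p)=|V|+\min\Big\{\sum_{X_i\in\mathcal X}(2|X_i|-3)+k(X)\Big\},$$ where the minimum is over all subsets $X\subseteq V$ and all $X$-restricted 1-thin covers $\mathcal X$ of $G$. -/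

import Mathlib

open MvPolynomial

noncomputable section

namespace ExpandingSpheres

variable {V C : Type*}

/-- The number `k(X)` of colours occurring in a set `X` of vertices, for a colouring
`χ : V → C ∪ {•}`; `none` is the sign `•`, i.e. `χ v = none` says that `v` is uncoloured. -/
def numColours [DecidableEq C] (χ : V → Option C) (X : Finset V) : ℕ :=
  (Finset.eraseNone (X.image χ)).card

/-- The radius of the sphere of a vertex: `r c` for colour `c`, and `1` for uncoloured vertices. -/
def radius (r : C → ℝ) : Option C → ℝ
  | none => 1
  | some c => r c

/-- A framework on the family `r𝕊^d` of concentric spheres in `ℝ^{d+1}`, for a vertex set `V` with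
colouring `χ`. -/
structure Framework (d : ℕ) (χ : V → Option C) where
  /-- the radii of the coloured spheres -/
  r : C → ℝ
  r_pos : ∀ c, 0 < r c
  /-- the positions of the joints -/
  p : V → EuclideanSpace ℝ (Fin (d + 1))
  mem_sphere : ∀ v, p v ∈ Metric.sphere (0 : EuclideanSpace ℝ (Fin (d + 1))) (radius r (χ v))

/-- The square of the radius as a polynomial: the square of the variable of colour `c`, or `1`. -/
def radiusSqPoly (V : Type*) {C : Type*} (d : ℕ) :
    Option C → MvPolynomial ((V × Fin (d + 1)) ⊕ C) ℚ
  | none => 1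
  | some c => X (Sum.inr c) ^ 2

/-- The defining polynomial of the sphere on which the vertex `v` lies. There is one variable for
each coordinate of each vertex and one variable for the radius of each colour. -/
def spherePoly {d : ℕ} (χ : V → Option C) (v : V) : MvPolynomial ((V × Fin (d + 1)) ⊕ C) ℚ :=
  (∑ i : Fin (d + 1), X (Sum.inl (v, i)) ^ 2) - radiusSqPoly V d (χ v)

/-- A framework on `r𝕊^d` is generic if every polynomial with rational coefficients that vanishes
at the coordinates of `p` and `r` is in the ideal generated by the defining polynomials of the
spheres. -/
def Framework.IsGeneric {d : ℕ} {χ : V → Option C} (P : Framework d χ) : Prop :=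
  ∀ f : MvPolynomial ((V × Fin (d + 1)) ⊕ C) ℚ,
    aeval (Sum.elim (fun x : V × Fin (d + 1) => P.p x.1 x.2) P.r) f = 0 →
      f ∈ Ideal.span (Set.range (spherePoly (d := d) χ))

/-- The rigidity matrix `R(G, χ, p)`. The rows are indexed by the edges and the vertices, the
columns by the `d + 1` coordinates of each vertex and by the colours. The row of an edge `uw` has
`p u - p w` in the columns of `u`, `p w - p u` in the columns of `w`, and zeros elsewhere. The row
of a vertex `v` has `p v` in the columns of `v`, a `1` in the column of the colour of `v` if `v` is
coloured, and zeros elsewhere. -/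
def rigidityMatrix [DecidableEq V] [DecidableEq C] {d : ℕ} (G : SimpleGraph V)
    (χ : V → Option C) (p : V → EuclideanSpace ℝ (Fin (d + 1))) :
    Matrix (G.edgeSet ⊕ V) ((V × Fin (d + 1)) ⊕ C) ℝ
  | Sum.inl e, Sum.inl (w, i) =>
      if h : w ∈ (e : Sym2 V) then p w i - p (Sym2.Mem.other h) i else 0
  | Sum.inl _, Sum.inr _ => 0
  | Sum.inr v, Sum.inl (w, i) => if w = v then p v i else 0
  | Sum.inr v, Sum.inr c => if χ v = some c then 1 else 0

/-- A cover of `G`: a family of vertex sets with at least two elements each, such that every edge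
of `G` is induced by a member of the family. -/
def IsCover (G : SimpleGraph V) (𝒳 : Finset (Finset V)) : Prop :=
  (∀ Y ∈ 𝒳, 2 ≤ Y.card) ∧ ∀ u v, G.Adj u v → ∃ Y ∈ 𝒳, u ∈ Y ∧ v ∈ Y

/-- A family of vertex sets is `1`-thin if any two of its members share at most one vertex. -/
def IsOneThin [DecidableEq V] (𝒳 : Finset (Finset V)) : Prop :=
  ∀ Y ∈ 𝒳, ∀ Z ∈ 𝒳, Y ≠ Z → (Y ∩ Z).card ≤ 1

/-- A family of vertex sets is `X`-restricted if its members with at least three elements are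
subsets of `X`. -/
def IsRestricted (X : Finset V) (𝒳 : Finset (Finset V)) : Prop :=
  ∀ Y ∈ 𝒳, 3 ≤ Y.card → Y ⊆ X

end ExpandingSpheres

end

/-!
The kernel of the rigidity matrix consists of the infinitesimal motions, so everything reduces to
the rank `rk D E` of the functionals `strain p e`, `e ∈ E`, on the motions of the vertices that stay
on their spheres, where only the radii of the colours in `D` may vary. With `D = ∅` all spheres are
rigid, and the rank is that of a generic bar-joint framework in the plane, given by the theorems of
Laman and of Lovász and Yemini.

Put `f T = rk ∅ T + #(colours in D occurring at T)`. Since `rk D T ≤ f T`, independence of `F`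
requires `#T ≤ f T` for all `T ⊆ F`, and for at most two colours this is sufficient. Indeed, `F`
then has a vertex `v` of degree at most three. Degree at most two is a generic `0`-extension. For
degree three with neighbours `N`, if no generic position of `v` gives an independent set, then every
motion of the rest is rigid on `N` and does not change the radii at `N` and `v`. Adding the edges on
`N` and freezing those radii therefore leaves the space of motions unchanged, and the rank formula
for the smaller graph yields a set `T` for which the count fails.

Since `f` is monotone and submodular, Edmonds' theorem on polymatroid matroids turns this
description of the independent sets into `rk D E = min_T (#(E ∖ T) + f T)`. Covering `T` optimally
by the Lovász–Yemini formula for `rk ∅ T`, and the edges outside `T` by their pairs of ends, gives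
the restricted cover attaining the minimum.
-/

noncomputable section

namespace ExpandingSpheres

open Matrix Module

section RankOn

variable {K M M' α : Type*} [Field K] [AddCommGroup M'] [Module K M'] [AddCommGroup M] [Module K M]

/-- The vectors of the subspace `S` at which all functionals `φ e` with `e ∈ F` vanish. -/
def jointKer (S : Submodule K M) (φ : α → M →ₗ[K] K) (F : Finset α) : Submodule K M :=
  S ⊓ ⨅ e ∈ F, LinearMap.ker (φ e)

/-- The rank of the family of functionals `φ e`, `e ∈ F`, restricted to the subspace `S`, encoded
as the codimension in `S` of their joint kernel. -/
def rankOn (S : Submodule K M) (φ : α → M →ₗ[K] K) (F : Finset α) : ℕ :=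
  finrank K S - finrank K (jointKer S φ F)

variable {S : Submodule K M} {S' : Submodule K M'} {φ : α → M →ₗ[K] K} {ψ : α → M' →ₗ[K] K}
  {F F' : Finset α}

theorem mem_jointKer {m : M} : m ∈ jointKer S φ F ↔ m ∈ S ∧ ∀ e ∈ F, φ e m = 0 := by
  simp [jointKer]

theorem jointKer_anti (h : F ⊆ F') : jointKer S φ F' ≤ jointKer S φ F := fun _ hm =>
  mem_jointKer.2 ⟨(mem_jointKer.1 hm).1, fun e he => (mem_jointKer.1 hm).2 e (h he)⟩

theorem jointKer_empty : jointKer S φ ∅ = S := by simp [jointKer]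

theorem jointKer_union [DecidableEq α] :
    jointKer S φ (F ∪ F') = jointKer S φ F ⊓ jointKer S φ F' := by
  ext m
  simp only [Submodule.mem_inf, mem_jointKer, Finset.mem_union, or_imp, forall_and]
  tauto

theorem jointKer_insert [DecidableEq α] (e : α) :
    jointKer S φ (insert e F) = jointKer S φ F ⊓ LinearMap.ker (φ e) := by
  ext m
  simp only [Submodule.mem_inf, mem_jointKer, Finset.forall_mem_insert, LinearMap.mem_ker]
  tauto

theorem rankOn_empty : rankOn S φ ∅ = 0 := by rw [rankOn, jointKer_empty, Nat.sub_self]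

theorem rankOn_insert_of_forall_eq_zero [DecidableEq α] {e : α}
    (he : ∀ m ∈ jointKer S φ F, φ e m = 0) : rankOn S φ (insert e F) = rankOn S φ F := by
  rw [rankOn, jointKer_insert, inf_eq_left.2 fun m hm => LinearMap.mem_ker.2 (he m hm), rankOn]

theorem rankOn_image [DecidableEq α] {β : Type*} (g : β → α) (F : Finset β) :
    rankOn S φ (F.image g) = rankOn S (φ ∘ g) F := by
  have hker : jointKer S φ (F.image g) = jointKer S (φ ∘ g) F := by
    ext m
    simp only [mem_jointKer, Finset.forall_mem_image, Function.comp_apply]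
  rw [rankOn, rankOn, hker]

variable [FiniteDimensional K M] [FiniteDimensional K M']

theorem rankOn_add_finrank_jointKer : rankOn S φ F + finrank K (jointKer S φ F) = finrank K S :=
  Nat.sub_add_cancel (Submodule.finrank_mono inf_le_left)

theorem rankOn_mono (h : F ⊆ F') : rankOn S φ F ≤ rankOn S φ F' :=
  Nat.sub_le_sub_left (Submodule.finrank_mono (jointKer_anti h)) _

theorem rankOn_union_add_rankOn_inter [DecidableEq α] (F F' : Finset α) :
    rankOn S φ (F ∪ F') + rankOn S φ (F ∩ F') ≤ rankOn S φ F + rankOn S φ F' := by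
  have hdim := Submodule.finrank_sup_add_finrank_inf_eq (jointKer S φ F) (jointKer S φ F')
  rw [← jointKer_union] at hdim
  have hsup : finrank K ↥(jointKer S φ F ⊔ jointKer S φ F') ≤
      finrank K (jointKer S φ (F ∩ F')) := Submodule.finrank_mono
    (sup_le (jointKer_anti Finset.inter_subset_left) (jointKer_anti Finset.inter_subset_right))
  have hunion := rankOn_add_finrank_jointKer (S := S) (φ := φ) (F := F ∪ F')
  have hinter := rankOn_add_finrank_jointKer (S := S) (φ := φ) (F := F ∩ F')
  have hF := rankOn_add_finrank_jointKer (S := S) (φ := φ) (F := F)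
  have hF' := rankOn_add_finrank_jointKer (S := S) (φ := φ) (F := F')
  omega

theorem finrank_le_finrank_inf_ker_add_one (S : Submodule K M) (f : M →ₗ[K] K) :
    finrank K S ≤ finrank K ↥(S ⊓ LinearMap.ker f) + 1 := by
  have hdim := Submodule.finrank_sup_add_finrank_inf_eq S (LinearMap.ker f)
  have hker := LinearMap.finrank_range_add_finrank_ker f
  have hrange : finrank K (LinearMap.range f) ≤ 1 :=
    (Submodule.finrank_le _).trans (finrank_self K).le
  have hsup := Submodule.finrank_le (S ⊔ LinearMap.ker f)
  omega

theorem rankOn_insert_le [DecidableEq α] (e : α) :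
    rankOn S φ (insert e F) ≤ rankOn S φ F + 1 := by
  have hker := finrank_le_finrank_inf_ker_add_one (jointKer S φ F) (φ e)
  rw [← jointKer_insert] at hker
  have hF := rankOn_add_finrank_jointKer (S := S) (φ := φ) (F := F)
  have hins := rankOn_add_finrank_jointKer (S := S) (φ := φ) (F := insert e F)
  omega

theorem rankOn_insert_of_ne_zero [DecidableEq α] {e : α} {m : M} (hm : m ∈ jointKer S φ F)
    (he : φ e m ≠ 0) : rankOn S φ (insert e F) = rankOn S φ F + 1 := by
  have hlt : finrank K (jointKer S φ (insert e F)) < finrank K (jointKer S φ F) := by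
    rw [jointKer_insert]
    exact Submodule.finrank_lt_finrank_of_lt
      (inf_le_left.lt_of_ne fun h => he (h.ge hm).2)
  have hle := rankOn_insert_le (S := S) (φ := φ) (F := F) e
  have hF := rankOn_add_finrank_jointKer (S := S) (φ := φ) (F := F)
  have hins := rankOn_add_finrank_jointKer (S := S) (φ := φ) (F := insert e F)
  omega

theorem rankOn_union_le_add_card [DecidableEq α] (F F' : Finset α) :
    rankOn S φ (F ∪ F') ≤ rankOn S φ F + F'.card := by
  induction F' using Finset.induction_on with
  | empty => simp
  | insert e F' he ih =>
    rw [Finset.union_insert, Finset.card_insert_of_notMem he]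
    have := rankOn_insert_le (S := S) (φ := φ) (F := F ∪ F') e
    omega

theorem rankOn_le_card : rankOn S φ F ≤ F.card := by
  classical
  simpa [rankOn_empty] using rankOn_union_le_add_card (S := S) (φ := φ) ∅ F

theorem rankOn_biUnion_le [DecidableEq α] {ι : Type*} (s : Finset ι) (A : ι → Finset α) :
    rankOn S φ (s.biUnion A) ≤ ∑ i ∈ s, rankOn S φ (A i) := by
  classical
  induction s using Finset.induction_on with
  | empty => simp [rankOn_empty]
  | insert i s hi ih =>
    rw [Finset.biUnion_insert, Finset.sum_insert hi]
    have := rankOn_union_add_rankOn_inter (S := S) (φ := φ) (A i) (s.biUnion A)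
    omega

theorem rankOn_le_rankOn (h : ∀ m ∈ S, ∃ m' ∈ S', ∀ e ∈ F, ψ e m' = φ e m) :
    rankOn S φ F ≤ rankOn S' ψ F := by
  classical
  induction F using Finset.induction_on with
  | empty => simp [rankOn_empty]
  | insert e F _ ih =>
    have hF := ih fun m hm => (h m hm).imp fun _ hm' => ⟨hm'.1, fun e he =>
      hm'.2 e (Finset.mem_insert_of_mem he)⟩
    by_cases hvanish : ∀ m ∈ jointKer S φ F, φ e m = 0
    · rw [rankOn_insert_of_forall_eq_zero hvanish]
      exact hF.trans (rankOn_mono (Finset.subset_insert e F))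
    · push Not at hvanish
      obtain ⟨m, hm, hem⟩ := hvanish
      obtain ⟨m', hm'S, hm'⟩ := h m (mem_jointKer.1 hm).1
      have hm'F : m' ∈ jointKer S' ψ F := mem_jointKer.2 ⟨hm'S, fun e he => by
        rw [hm' e (Finset.mem_insert_of_mem he), (mem_jointKer.1 hm).2 e he]⟩
      rw [rankOn_insert_of_ne_zero hm hem, rankOn_insert_of_ne_zero hm'F
        (by rwa [hm' e (Finset.mem_insert_self e F)])]
      exact Nat.add_le_add_right hF 1

end RankOn

section Edmonds

variable {α : Type*} [DecidableEq α] {f : Finset α → ℕ}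

theorem apply_union_le_of_forall_apply_insert_le (hmono : Monotone f)
    (hsub : ∀ S T, f (S ∪ T) + f (S ∩ T) ≤ f S + f T) {T A : Finset α}
    (h : ∀ e ∈ A, f (insert e T) ≤ f T) : f (T ∪ A) ≤ f T := by
  induction A using Finset.induction_on with
  | empty => simp
  | insert e A _ ih =>
    rw [Finset.forall_mem_insert] at h
    have hunion : (T ∪ A) ∪ insert e T = T ∪ insert e A := by grind
    have hinter : T ⊆ (T ∪ A) ∩ insert e T := by grind
    have hsub' := hsub (T ∪ A) (insert e T)
    rw [hunion] at hsub'
    have := hmono hinter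
    have := ih h.2
    omega

theorem exists_tight_subset_forall_subset (hsub : ∀ S T, f (S ∪ T) + f (S ∩ T) ≤ f S + f T)
    (hzero : f ∅ = 0) {F : Finset α} (hF : ∀ T ⊆ F, T.card ≤ f T) :
    ∃ T ⊆ F, f T = T.card ∧ ∀ S ⊆ F, f S = S.card → S ⊆ T := by
  obtain ⟨T, hT, hmax⟩ := (F.powerset.filter fun T => f T = T.card).exists_max_image Finset.card
    ⟨∅, by simp [hzero]⟩
  simp only [Finset.mem_filter, Finset.mem_powerset] at hT hmax
  refine ⟨T, hT.1, hT.2, fun S hS hSf => ?_⟩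
  have hunion := hF (S ∪ T) (Finset.union_subset hS hT.1)
  have hinter := hF (S ∩ T) (Finset.inter_subset_left.trans hS)
  have hcard := Finset.card_union_add_card_inter S T
  have htight : f (S ∪ T) = (S ∪ T).card := by have := hsub S T; omega
  have hle := hmax (S ∪ T) ⟨Finset.union_subset hS hT.1, htight⟩
  rw [Finset.eq_of_subset_of_card_le Finset.subset_union_right hle]
  exact Finset.subset_union_left

theorem apply_insert_le_of_not_indep (hmono : Monotone f)
    (hsub : ∀ S T, f (S ∪ T) + f (S ∩ T) ≤ f S + f T) {F T : Finset α} {e : α}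
    (hF : ∀ T ⊆ F, T.card ≤ f T) (hT : ∀ S ⊆ F, f S = S.card → S ⊆ T)
    (he : ¬∀ S ⊆ insert e F, S.card ≤ f S) : f (insert e T) ≤ f T := by
  push Not at he
  obtain ⟨S, hS, hlt⟩ := he
  have heS : e ∈ S := by
    by_contra h
    exact hlt.not_ge (hF S ((Finset.subset_insert_iff_of_notMem h).1 hS))
  have hS' : S.erase e ⊆ F := Finset.subset_insert_iff.1 hS
  have hcard := Finset.card_erase_add_one heS
  have hind := hF _ hS'
  have herase : f (S.erase e) ≤ f S := hmono (Finset.erase_subset e S)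
  have hST : S.erase e ⊆ T := hT _ hS' (by omega)
  have hinter : f (S.erase e) ≤ f (S ∩ T) :=
    hmono (Finset.subset_inter (Finset.erase_subset e S) hST)
  have hunion : f (insert e T) ≤ f (S ∪ T) :=
    hmono (Finset.insert_subset (Finset.mem_union_left _ heS) Finset.subset_union_right)
  have := hsub S T
  omega

/-- One half of Edmonds' rank formula for the matroid of an integral polymatroid: the sets `F` with
`|T| ≤ f T` for all `T ⊆ F` are its independent sets. -/
theorem exists_indep_card_sdiff_add_le (hmono : Monotone f)
    (hsub : ∀ S T, f (S ∪ T) + f (S ∩ T) ≤ f S + f T) (hzero : f ∅ = 0) (E : Finset α) :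
    ∃ F ⊆ E, (∀ T ⊆ F, T.card ≤ f T) ∧ ∃ T ⊆ E, (E \ T).card + f T ≤ F.card := by
  obtain ⟨F, hF, hmax⟩ := (E.powerset.filter fun F => ∀ T ⊆ F, T.card ≤ f T).exists_max_image
    Finset.card ⟨∅, by simp⟩
  simp only [Finset.mem_filter, Finset.mem_powerset] at hF hmax
  obtain ⟨hFE, hind⟩ := hF
  obtain ⟨T, hTF, hTf, hT⟩ := exists_tight_subset_forall_subset hsub hzero hind
  have hle : f (T ∪ (E \ F)) ≤ f T := by
    refine apply_union_le_of_forall_apply_insert_le hmono hsub fun e he => ?_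
    rw [Finset.mem_sdiff] at he
    refine apply_insert_le_of_not_indep hmono hsub hind hT fun h => ?_
    have := hmax _ ⟨Finset.insert_subset he.1 hFE, h⟩
    rw [Finset.card_insert_of_notMem he.2] at this
    omega
  refine ⟨F, hFE, hind, T ∪ (E \ F), Finset.union_subset (hTF.trans hFE) Finset.sdiff_subset, ?_⟩
  have hsdiff : E \ (T ∪ (E \ F)) ⊆ F \ T := by grind
  have hcard := Finset.card_sdiff_add_card_eq_card hTF
  have := Finset.card_le_card hsdiff
  omega

end Edmonds

section Motions

/-- An infinitesimal motion assigns a velocity in `ℝⁿ` to each vertex and, to each colour, the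
speed at which half the square of the radius of its sphere shrinks. -/
abbrev Velocity (n : ℕ) (V C : Type*) := (V → Fin n → ℝ) × (C → ℝ)

variable {n : ℕ} {V C : Type*}

/-- The speed of the sphere of a vertex; the sphere of the uncoloured vertices is fixed. -/
def speed (o : Option C) : (C → ℝ) →ₗ[ℝ] ℝ := o.elim 0 LinearMap.proj

@[simp] theorem speed_none (σ : C → ℝ) : speed none σ = 0 := rfl

@[simp] theorem speed_some (c : C) (σ : C → ℝ) : speed (some c) σ = σ c := rfl

/-- The functional sending an infinitesimal motion to the rate of change of half the square of the
distance between the ends of an edge. -/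
def strain (p : V → Fin n → ℝ) : Sym2 V → Velocity n V C →ₗ[ℝ] ℝ :=
  Sym2.lift ⟨fun u w =>
    { toFun m := (p u - p w) ⬝ᵥ (m.1 u - m.1 w)
      map_add' m m' := by
        simp only [Prod.fst_add, Pi.add_apply, dotProduct_sub, dotProduct_add]
        ring
      map_smul' a m := by
        simp only [Prod.smul_fst, Pi.smul_apply, ← smul_sub, dotProduct_smul, RingHom.id_apply] },
    fun u w => LinearMap.ext fun m => by
      change (p u - p w) ⬝ᵥ (m.1 u - m.1 w) = (p w - p u) ⬝ᵥ (m.1 w - m.1 u)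
      rw [← neg_sub, neg_dotProduct, ← dotProduct_neg, neg_sub]⟩

theorem strain_mk (p : V → Fin n → ℝ) (u w : V) (m : Velocity n V C) :
    strain p s(u, w) m = (p u - p w) ⬝ᵥ (m.1 u - m.1 w) := rfl

theorem strain_congr {p p' : V → Fin n → ℝ} {m m' : Velocity n V C} {e : Sym2 V}
    (hp : ∀ v ∈ e, p v = p' v) (hm : ∀ v ∈ e, m.1 v = m'.1 v) : strain p e m = strain p' e m' := by
  induction e with | _ u w => ?_
  simp only [Sym2.mem_iff, forall_eq_or_imp, forall_eq] at hp hm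
  rw [strain_mk, strain_mk, hp.1, hp.2, hm.1, hm.2]

/-- The derivatives of the conditions that the vertices stay on their spheres and that the radii of
the colours outside `D` stay constant. -/
def sphereConstraint (χ : V → Option C) (p : V → Fin n → ℝ) (D : Finset C) :
    Velocity n V C →ₗ[ℝ] (V → ℝ) × ({c // c ∉ D} → ℝ) :=
  (LinearMap.pi fun v => dotProductBilin ℝ ℝ (p v) ∘ₗ LinearMap.proj v ∘ₗ LinearMap.fst ℝ _ _ +
      speed (χ v) ∘ₗ LinearMap.snd ℝ _ _).prod
    (LinearMap.pi fun c => LinearMap.proj c.1 ∘ₗ LinearMap.snd ℝ _ _)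

/-- The infinitesimal motions that keep the vertices on their spheres and in which only the radii
of the colours in `D` vary. -/
def sphereMotions (χ : V → Option C) (p : V → Fin n → ℝ) (D : Finset C) :
    Submodule ℝ (Velocity n V C) :=
  LinearMap.ker (sphereConstraint χ p D)

/-- The infinitesimal motions of the edge set `F` on the spheres, where only the radii of the
colours in `D` vary. -/
def motions (χ : V → Option C) (p : V → Fin n → ℝ) (D : Finset C) (F : Finset (Sym2 V)) :
    Submodule ℝ (Velocity n V C) :=
  jointKer (sphereMotions χ p D) (strain p) F

/-- The rank of the edge set `F` in the rigidity matroid on the spheres, where only the radii of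
the colours in `D` vary. -/
def rk (χ : V → Option C) (p : V → Fin n → ℝ) (D : Finset C) (F : Finset (Sym2 V)) : ℕ :=
  rankOn (sphereMotions χ p D) (strain p) F

variable {χ : V → Option C} {p : V → Fin n → ℝ} {D D' : Finset C} {F : Finset (Sym2 V)}
  {m : Velocity n V C}

theorem mem_sphereMotions : m ∈ sphereMotions χ p D ↔
    (∀ v, p v ⬝ᵥ m.1 v + speed (χ v) m.2 = 0) ∧ ∀ c ∉ D, m.2 c = 0 := by
  simp [sphereMotions, sphereConstraint, LinearMap.ker_prod, LinearMap.ker_pi]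

theorem mem_motions : m ∈ motions χ p D F ↔
    m ∈ sphereMotions χ p D ∧ ∀ e ∈ F, strain p e m = 0 := mem_jointKer

theorem sphereMotions_mono (h : D ⊆ D') : sphereMotions χ p D ≤ sphereMotions χ p D' :=
  fun _ hm => mem_sphereMotions.2
    ⟨(mem_sphereMotions.1 hm).1, fun c hc => (mem_sphereMotions.1 hm).2 c fun hc' => hc (h hc')⟩

theorem motions_mono (h : D ⊆ D') : motions χ p D F ≤ motions χ p D' F :=
  inf_le_inf_right _ (sphereMotions_mono h)

theorem range_sphereConstraint (hp : ∀ v, p v ≠ 0) :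
    LinearMap.range (sphereConstraint χ p D) = ⊤ := by
  classical
  refine LinearMap.range_eq_top.2 fun ⟨b, t⟩ => ?_
  let σ : C → ℝ := fun c => if hc : c ∉ D then t ⟨c, hc⟩ else 0
  refine ⟨(fun v => ((b v - speed (χ v) σ) / (p v ⬝ᵥ p v)) • p v, σ), ?_⟩
  ext v
  · have hv : p v ⬝ᵥ p v ≠ 0 := fun h => hp v (dotProduct_self_eq_zero.1 h)
    simp [sphereConstraint, hv]
  · simp [sphereConstraint, σ, v.2]

theorem finrank_sphereMotions [Finite V] [Finite C] (hp : ∀ v, p v ≠ 0) :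
    finrank ℝ (sphereMotions χ p D) + Nat.card V = n * Nat.card V + D.card := by
  classical
  cases nonempty_fintype V
  cases nonempty_fintype C
  have hker := LinearMap.finrank_range_add_finrank_ker (sphereConstraint χ p D)
  rw [range_sphereConstraint hp, finrank_top, ← sphereMotions] at hker
  simp only [finrank_prod, finrank_fintype_fun_eq_card, finrank_pi_fintype, Fintype.card_fin,
    Finset.sum_const, Finset.card_univ, smul_eq_mul, Fintype.card_subtype_compl,
    Fintype.card_coe] at hker
  have hD := Finset.card_le_univ D
  rw [Nat.card_eq_fintype_card, mul_comm n]
  omega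

/-- The colours in `D` that occur at an edge of `F`. -/
def coloursAt (χ : V → Option C) (D : Finset C) (F : Finset (Sym2 V)) : Finset C :=
  open Classical in {c ∈ D | ∃ e ∈ F, ∃ v ∈ e, χ v = some c}

theorem mem_coloursAt {c : C} :
    c ∈ coloursAt χ D F ↔ c ∈ D ∧ ∃ e ∈ F, ∃ v ∈ e, χ v = some c := by
  simp [coloursAt]

theorem update_mem_motions [DecidableEq V] {p' : V → Fin n → ℝ} {v : V} {y : Fin n → ℝ}
    (hpp' : ∀ w ≠ v, p w = p' w) (hF : ∀ e ∈ F, v ∉ e) (hm : m ∈ motions χ p D F)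
    (hy : p' v ⬝ᵥ y + speed (χ v) m.2 = 0) :
    (Function.update m.1 v y, m.2) ∈ motions χ p' D F := by
  obtain ⟨hmS, hmF⟩ := mem_motions.1 hm
  obtain ⟨hsphere, hD⟩ := mem_sphereMotions.1 hmS
  refine mem_motions.2 ⟨mem_sphereMotions.2 ⟨fun w => ?_, hD⟩, fun e he => ?_⟩
  · rcases eq_or_ne w v with rfl | hw
    · simpa using hy
    · simpa [hw, ← hpp' w hw] using hsphere w
  · rw [← hmF e he]
    have hne : ∀ w ∈ e, w ≠ v := fun w hw hwv => hF e he (hwv ▸ hw)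
    exact strain_congr (fun w hw => (hpp' w (hne w hw)).symm)
      fun w hw => Function.update_of_ne (hne w hw) _ _

theorem exists_mem_motions_of_eqOn {p' : V → Fin n → ℝ} {v : V} (hpp' : ∀ w ≠ v, p w = p' w)
    (hv : p' v ≠ 0) (hF : ∀ e ∈ F, v ∉ e) (hm : m ∈ motions χ p D F) :
    ∃ m' ∈ motions χ p' D F, (∀ w ≠ v, m'.1 w = m.1 w) ∧ m'.2 = m.2 := by
  classical
  have hv' : p' v ⬝ᵥ p' v ≠ 0 := fun h => hv (dotProduct_self_eq_zero.1 h)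
  exact ⟨_, update_mem_motions (y := (-speed (χ v) m.2 / (p' v ⬝ᵥ p' v)) • p' v) hpp' hF hm
    (by simp [hv']), fun w hw => Function.update_of_ne hw _ _, rfl⟩

variable [Finite V] [Finite C]

theorem rk_add_finrank (hp : ∀ v, p v ≠ 0) :
    rk χ p D F + finrank ℝ (motions χ p D F) + Nat.card V = n * Nat.card V + D.card := by
  rw [rk, motions, rankOn_add_finrank_jointKer, finrank_sphereMotions hp]

theorem rk_le_rk_coloursAt : rk χ p D F ≤ rk χ p (coloursAt χ D F) F := by
  classical
  refine rankOn_le_rankOn fun m hm => ?_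
  obtain ⟨hsphere, hD⟩ := mem_sphereMotions.1 hm
  let idle (v : V) : Prop := ∃ c ∈ D, c ∉ coloursAt χ D F ∧ χ v = some c
  refine ⟨(fun v => if idle v then 0 else m.1 v, fun c => if c ∈ coloursAt χ D F then m.2 c else 0),
    mem_sphereMotions.2 ⟨fun v => ?_, fun c hc => if_neg hc⟩, fun e he => ?_⟩
  · have := hsphere v
    rcases hv : χ v with _ | c
    · simpa [idle, hv] using this
    · by_cases hcF : c ∈ coloursAt χ D F
      · simpa [idle, hv, hcF] using this
      · by_cases hcD : c ∈ D
        · simp [idle, hv, hcF, hcD]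
        · simpa [idle, hv, hcF, hcD, hD c hcD] using this
  · refine strain_congr (fun _ _ => rfl) fun v hv => if_neg ?_
    rintro ⟨c, hcD, hcF, hχ⟩
    exact hcF (mem_coloursAt.2 ⟨hcD, e, he, v, hv, hχ⟩)

theorem rk_le_rk_empty_add_card_coloursAt (hp : ∀ v, p v ≠ 0) :
    rk χ p D F ≤ rk χ p ∅ F + (coloursAt χ D F).card := by
  have hfull := rk_add_finrank (χ := χ) (D := coloursAt χ D F) (F := F) hp
  have hempty := rk_add_finrank (χ := χ) (D := ∅) (F := F) hp
  have hle : finrank ℝ (motions χ p ∅ F) ≤ finrank ℝ (motions χ p (coloursAt χ D F) F) :=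
    Submodule.finrank_mono (motions_mono (Finset.empty_subset _))
  have := rk_le_rk_coloursAt (χ := χ) (p := p) (D := D) (F := F)
  rw [Finset.card_empty] at hempty
  omega

theorem rk_image_map_le [DecidableEq V] {U : Type*} [Finite U] (f : U → V) (F : Finset (Sym2 U)) :
    rk χ p D (F.image (Sym2.map f)) ≤ rk (χ ∘ f) (p ∘ f) D F := by
  rw [rk, rankOn_image]
  refine rankOn_le_rankOn fun m hm => ⟨(m.1 ∘ f, m.2), ?_, fun e _ => ?_⟩
  · obtain ⟨hsphere, hD⟩ := mem_sphereMotions.1 hm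
    exact mem_sphereMotions.2 ⟨fun u => hsphere (f u), hD⟩
  · induction e with | _ u w => rfl

theorem rk_le_rk_of_eqOn {p' : V → Fin n → ℝ} {v : V} (hpp' : ∀ w ≠ v, p w = p' w) (hv : p' v ≠ 0)
    (hF : ∀ e ∈ F, v ∉ e) : rk χ p D F ≤ rk χ p' D F := by
  refine rankOn_le_rankOn fun m hm => ?_
  obtain ⟨m', hm', hmv, -⟩ := exists_mem_motions_of_eqOn (F := ∅) hpp' hv (by simp)
    (mem_motions.2 ⟨hm, by simp⟩)
  refine ⟨m', (mem_motions.1 hm').1, fun e he => ?_⟩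
  have hne : ∀ w ∈ e, w ≠ v := fun w hw hwv => hF e he (hwv ▸ hw)
  exact strain_congr (fun w hw => (hpp' w (hne w hw)).symm) fun w hw => hmv w (hne w hw)

end Motions

section Rotations

variable {V C : Type*} {χ : V → Option C} {p : V → Fin 3 → ℝ} {D : Finset C} {F : Finset (Sym2 V)}

theorem eq_zero_of_cross_eq_zero {x a b : Fin 3 → ℝ} (h : a ⨯₃ b ≠ 0) (ha : x ⨯₃ a = 0)
    (hb : x ⨯₃ b = 0) : x = 0 := by
  by_contra hx
  have hparallel : ∀ {y}, x ⨯₃ y = 0 → ∃ t : ℝ, t • x = y := fun {y} hy => by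
    by_contra! hne
    exact crossProduct_ne_zero_iff_linearIndependent.2 ((LinearIndependent.pair_iff' hx).2 hne) hy
  obtain ⟨s, rfl⟩ := hparallel ha
  obtain ⟨t, rfl⟩ := hparallel hb
  exact h (by simp)

/-- The infinitesimal rotation about the axis `x`. -/
def rotation (C : Type*) (p : V → Fin 3 → ℝ) : (Fin 3 → ℝ) →ₗ[ℝ] Velocity 3 V C :=
  (LinearMap.pi fun v => crossProduct.flip (p v)).prod 0

theorem rotation_mem_motions (x : Fin 3 → ℝ) : rotation C p x ∈ motions χ p D F := by
  refine mem_motions.2 ⟨mem_sphereMotions.2 ⟨fun v => ?_, fun c _ => rfl⟩, fun e _ => ?_⟩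
  · simp [rotation]
  · induction e with | _ u w => ?_
    change (p u - p w) ⬝ᵥ (x ⨯₃ p u - x ⨯₃ p w) = 0
    rw [← map_sub, dot_cross_self]

theorem rotation_injective {a b : V} (hab : p a ⨯₃ p b ≠ 0) :
    Function.Injective (rotation C p) := by
  refine (injective_iff_map_eq_zero _).2 fun x hx => ?_
  have hv : ∀ v, x ⨯₃ p v = 0 := congrFun (congrArg Prod.fst hx)
  exact eq_zero_of_cross_eq_zero hab (hv a) (hv b)

theorem rk_empty_add_three_le_card [Finite V] [Finite C] (hp : ∀ v, p v ≠ 0) {a b : V}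
    (hab : p a ⨯₃ p b ≠ 0) : rk χ p ∅ F + 3 ≤ 2 * Nat.card V := by
  have hrot : finrank ℝ (Fin 3 → ℝ) ≤ finrank ℝ (motions χ p ∅ F) := by
    refine LinearMap.finrank_le_finrank_of_injective
      (f := (rotation C p).codRestrict _ rotation_mem_motions) ?_
    exact ((rotation C p).injective_codRestrict_iff rotation_mem_motions).2
      (rotation_injective hab)
  have := rk_add_finrank (χ := χ) (D := ∅) (F := F) hp
  rw [finrank_fin_fun] at hrot
  rw [Finset.card_empty] at this
  omega

theorem rk_empty_add_three_le [Finite V] [Finite C] (hp : ∀ v, p v ≠ 0) {W : Finset V}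
    (hF : F ⊆ W.sym2) {a b : V} (ha : a ∈ W) (hb : b ∈ W) (hab : p a ⨯₃ p b ≠ 0) :
    rk χ p ∅ F + 3 ≤ 2 * W.card := by
  classical
  have himage : W.sym2 = W.attach.sym2.image (Sym2.map Subtype.val) := by
    rw [← Finset.sym2_image, Finset.attach_image_val]
  obtain ⟨F', -, rfl⟩ := Finset.subset_image_iff.1 (himage ▸ hF)
  have hle := rk_image_map_le (χ := χ) (p := p) (D := ∅) (Subtype.val : W → V) F'
  have := rk_empty_add_three_le_card (χ := χ ∘ Subtype.val) (F := F') (fun v : W => hp v)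
    (a := ⟨a, ha⟩) (b := ⟨b, hb⟩) hab
  rw [Nat.card_eq_fintype_card, Fintype.card_coe] at this
  exact (Nat.add_le_add_right hle 3).trans this

end Rotations

section Cone

variable {V : Type*} [DecidableEq V] {v w : V} {N : Finset V} {F : Finset (Sym2 V)}

/-- The edge set `F` together with the edges from `v` to the vertices in `N`. -/
def cone (v : V) (N : Finset V) (F : Finset (Sym2 V)) : Finset (Sym2 V) :=
  N.image (fun w => s(v, w)) ∪ F

theorem mem_cone {e : Sym2 V} : e ∈ cone v N F ↔ (∃ w ∈ N, s(v, w) = e) ∨ e ∈ F := by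
  simp [cone]

theorem cone_insert : cone v (insert w N) F = insert s(v, w) (cone v N F) := by
  rw [cone, Finset.image_insert, Finset.insert_union, cone]

theorem card_cone (hF : ∀ e ∈ F, v ∉ e) : (cone v N F).card = F.card + N.card := by
  have hdisj : Disjoint (N.image fun w => s(v, w)) F := by
    refine Finset.disjoint_left.2 fun e he heF => hF e heF ?_
    obtain ⟨w, -, rfl⟩ := Finset.mem_image.1 he
    exact Sym2.mem_mk_left v w
  rw [cone, Finset.card_union_of_disjoint hdisj,
    Finset.card_image_of_injective _ fun _ _ => Sym2.congr_right.1, add_comm]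

end Cone

section Extension

theorem exists_dotProduct_eq {n : ℕ} {V : Type*} {p : V → Fin n → ℝ} {s : Set V}
    (h : LinearIndepOn ℝ p s) (b : V → ℝ) : ∃ y, ∀ w ∈ s, p w ⬝ᵥ y = b w := by
  let B := Basis.span h
  obtain ⟨ℓ, hℓ⟩ := (B.constr ℝ fun w => b w).exists_extend
  obtain ⟨y, rfl⟩ := (dotProductEquiv ℝ (Fin n)).surjective ℓ
  refine ⟨y, fun w hw => ?_⟩
  have hB : (B ⟨w, hw⟩ : Fin n → ℝ) = p w := congrArg Subtype.val (Basis.span_apply h _)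
  have := LinearMap.congr_fun hℓ (B ⟨w, hw⟩)
  rwa [Basis.constr_basis, LinearMap.comp_apply, Submodule.subtype_apply, hB,
    dotProductEquiv_apply_apply, dotProduct_comm] at this

section Obstruction

variable {ι κ : Type*} [Fintype ι] [Fintype κ]

/-- If the point `v = ∑ xᵢ aᵢ` is joined by bars to the points `aᵢ`, then velocities `a'ᵢ` of the
`aᵢ` extend to `v` only if this vanishes. Here `sᵥ` and `sᵢ` are the speeds of the spheres and
`ηᵢⱼ` is the strain between `aᵢ` and `aⱼ`. -/
def extensionObstruction (η : Matrix ι ι ℝ) (s : ι → ℝ) (sv : ℝ) (x : ι → ℝ) : ℝ :=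
  2 * (1 - x ⬝ᵥ 1) * (x ⬝ᵥ s - sv) - x ⬝ᵥ η *ᵥ x

theorem dotProduct_of_strain_mulVec {a a' : Matrix ι κ ℝ} {x s : ι → ℝ}
    (ha : ∀ i, a i ⬝ᵥ a' i + s i = 0) :
    x ⬝ᵥ (of fun i j => (a i - a j) ⬝ᵥ (a' i - a' j)) *ᵥ x =
      -2 * ((x ⬝ᵥ 1) * (x ⬝ᵥ s) + (x ᵥ* a) ⬝ᵥ (x ᵥ* a')) := by
  have hη : (of fun i j => (a i - a j) ⬝ᵥ (a' i - a' j)) =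
      -(vecMulVec s 1 + vecMulVec 1 s + a * a'ᵀ + a' * aᵀ) := by
    ext i j
    have hi := ha i
    have hj := ha j
    simp only [of_apply, Matrix.neg_apply, Matrix.add_apply, vecMulVec_apply, Pi.one_apply,
      mul_one, one_mul]
    change (a i - a j) ⬝ᵥ (a' i - a' j) = -(s i + s j + a i ⬝ᵥ a' j + a' i ⬝ᵥ a j)
    rw [sub_dotProduct, dotProduct_sub, dotProduct_sub, dotProduct_comm (a' i)]
    linarith
  rw [hη]
  simp only [neg_mulVec, add_mulVec, vecMulVec_mulVec, ← mulVec_mulVec, dotProduct_neg,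
    dotProduct_add, dotProduct_smul, mulVec_transpose, dotProduct_mulVec, op_smul_eq_mul,
    dotProduct_comm s x, dotProduct_comm 1 x, dotProduct_comm (x ᵥ* a') (x ᵥ* a)]
  ring

theorem extensionObstruction_eq_zero {a a' : Matrix ι κ ℝ} {v v' : κ → ℝ} {x s : ι → ℝ} {sv : ℝ}
    (hv : v = x ᵥ* a) (hv' : v ⬝ᵥ v' + sv = 0) (ha : ∀ i, a i ⬝ᵥ a' i + s i = 0)
    (h : ∀ i, (v - a i) ⬝ᵥ (v' - a' i) = 0) :
    extensionObstruction (of fun i j => (a i - a j) ⬝ᵥ (a' i - a' j)) s sv x = 0 := by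
  have hbars : (x ⬝ᵥ 1) * (v ⬝ᵥ v') - v ⬝ᵥ (x ᵥ* a') - v ⬝ᵥ v' - x ⬝ᵥ s = 0 := by
    have hvec : (v ⬝ᵥ v') • (1 : ι → ℝ) - a' *ᵥ v - a *ᵥ v' - s = 0 := by
      ext i
      have hi := h i
      have hi' := ha i
      simp only [sub_dotProduct, dotProduct_sub] at hi
      simp only [Pi.sub_apply, Pi.smul_apply, Pi.one_apply, mulVec, Pi.zero_apply, smul_eq_mul]
      rw [dotProduct_comm (fun j => a' i j) v]
      linarith
    have := congrArg (x ⬝ᵥ ·) hvec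
    simp only [dotProduct_sub, dotProduct_smul, dotProduct_mulVec, dotProduct_zero, ← hv,
      smul_eq_mul] at this
    rw [dotProduct_comm v (x ᵥ* a')]
    linarith
  rw [extensionObstruction, dotProduct_of_strain_mulVec ha, ← hv]
  linear_combination -2 * hbars + 2 * (x ⬝ᵥ 1 - 1) * hv'

variable {a : Matrix ι κ ℝ} {η : Matrix ι ι ℝ} {s : ι → ℝ} {sv r : ℝ}

theorem odd_even_of_forall_extensionObstruction_eq_zero (hr : 0 < r)
    (h : ∀ x, (x ᵥ* a) ⬝ᵥ (x ᵥ* a) = r → extensionObstruction η s sv x = 0) {x : ι → ℝ}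
    (hx : x ᵥ* a ≠ 0) :
    x ⬝ᵥ s + (x ⬝ᵥ 1) * sv = 0 ∧
      r * (2 * (x ⬝ᵥ 1) * (x ⬝ᵥ s) + x ⬝ᵥ η *ᵥ x) = -2 * sv * ((x ᵥ* a) ⬝ᵥ (x ᵥ* a)) := by
  set q := (x ᵥ* a) ⬝ᵥ (x ᵥ* a) with hq
  have hq0 : 0 < q := (Finset.sum_nonneg fun i _ => mul_self_nonneg _).lt_of_ne'
    fun h => hx (dotProduct_self_eq_zero.1 h)
  obtain ⟨t, ht0, htq⟩ : ∃ t : ℝ, t ≠ 0 ∧ t * t * q = r :=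
    ⟨√(r / q), (Real.sqrt_pos.2 (div_pos hr hq0)).ne', by
      rw [Real.mul_self_sqrt (div_pos hr hq0).le, div_mul_cancel₀ _ hq0.ne']⟩
  have hscale : ∀ u : ℝ, u * u = t * t →
      2 * (1 - u * x ⬝ᵥ 1) * (u * x ⬝ᵥ s - sv) - u * (u * x ⬝ᵥ η *ᵥ x) = 0 := fun u hu => by
    simpa [extensionObstruction, mulVec_smul] using
      h (u • x) (by simp [smul_vecMul, ← hq, ← mul_assoc, hu, htq])
  have hpos := hscale t rfl
  have hneg := hscale (-t) (neg_mul_neg t t)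
  constructor
  · exact mul_left_cancel₀ ht0 (by linear_combination (hpos - hneg) / 4)
  · rw [← htq]
    linear_combination -q * (hpos + hneg) / 2

theorem exists_extensionObstruction_ne_zero [Nonempty ι] (ha : LinearIndependent ℝ a) (hr : 0 < r)
    (hs : ∀ i, a i ⬝ᵥ a i = r → s i = sv) (hη : η.IsSymm) (hdiag : ∀ i, η i i = 0)
    (hne : ¬(sv = 0 ∧ s = 0 ∧ η = 0)) :
    ∃ x, (x ᵥ* a) ⬝ᵥ (x ᵥ* a) = r ∧ extensionObstruction η s sv x ≠ 0 := by
  classical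
  by_contra! h
  have hinj : ∀ x : ι → ℝ, x ≠ 0 → x ᵥ* a ≠ 0 := fun x hx h0 =>
    hx (vecMul_injective_iff.2 ha (h0.trans (zero_vecMul a).symm))
  have hodd_even := fun x hx =>
    odd_even_of_forall_extensionObstruction_eq_zero hr h (hinj x hx)
  have hsingle : ∀ i, s i + sv = 0 ∧ r * s i = -(sv * (a i ⬝ᵥ a i)) := fun i => by
    have hi := hodd_even (Pi.single i 1) (by simp)
    simp only [single_one_vecMul, single_one_dotProduct, Pi.one_apply, mulVec_single_one, col_apply,
      hdiag i] at hi
    change _ ∧ _ = -2 * sv * (a i ⬝ᵥ a i) at hi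
    constructor <;> linarith [hi.1, hi.2]
  have hsv : sv = 0 := by
    obtain ⟨i⟩ := ‹Nonempty ι›
    by_contra h0
    have hri : a i ⬝ᵥ a i = r := mul_left_cancel₀ h0
      (by linear_combination (hsingle i).2 - r * (hsingle i).1)
    exact h0 (by linarith [hs i hri, (hsingle i).1])
  subst hsv
  obtain rfl : s = 0 := funext fun i => by simpa using (hsingle i).1
  have hquad : ∀ x ≠ 0, x ⬝ᵥ η *ᵥ x = 0 := fun x hx => by
    simpa [hr.ne'] using (hodd_even x hx).2
  refine hne ⟨rfl, rfl, ?_⟩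
  ext i j
  rcases eq_or_ne i j with rfl | hij
  · exact hdiag i
  · have hx : (Pi.single i 1 + Pi.single j 1 : ι → ℝ) ≠ 0 := fun h0 => by
      simpa [hij] using congrFun h0 i
    have hij' := hquad _ hx
    simp only [mulVec_add, mulVec_single_one, add_dotProduct, dotProduct_add, single_one_dotProduct,
      col_apply, hdiag, hη.apply i j] at hij'
    simpa using hij'

end Obstruction

variable {n : ℕ} {V C : Type*} [DecidableEq V] {χ : V → Option C}
  {p : V → Fin n → ℝ} {D : Finset C} {F : Finset (Sym2 V)} {N : Finset V} {v : V}

theorem linearIndepOn_insert_erase {x : N → ℝ} {c : N} (hN : LinearIndepOn ℝ p N)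
    (hv : p v = x ᵥ* of fun i : N => p i) (hc : x c ≠ 0) :
    LinearIndepOn ℝ p (insert v (N.erase c) : Finset V) := by
  obtain ⟨y, hy⟩ := exists_dotProduct_eq hN fun w => if w = c then 1 else 0
  have hvy : p v ⬝ᵥ y = x c := by
    have hmul : (of fun i : N => p i) *ᵥ y = Pi.single c 1 := by
      ext i
      exact (hy i i.2).trans (by simp [Pi.single_apply])
    rw [hv, ← dotProduct_mulVec, hmul, dotProduct_single_one]
  have hspan : Submodule.span ℝ (p '' (N.erase c : Finset V)) ≤
      LinearMap.ker (dotProductEquiv ℝ (Fin n) y) := by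
    refine Submodule.span_le.2 ?_
    rintro _ ⟨w, hw, rfl⟩
    have hw := Finset.mem_erase.1 hw
    simpa [hw.1, dotProduct_comm y] using hy w hw.2
  have hnot : p v ∉ Submodule.span ℝ (p '' (N.erase c : Finset V)) := fun h =>
    hc (by rw [← hvy, dotProduct_comm]; exact hspan h)
  rw [Finset.coe_insert]
  exact (hN.mono (Finset.coe_subset.2 (Finset.erase_subset _ _))).insert hnot

theorem exists_mem_motions_cone_erase {m : Velocity n V C} {x : N → ℝ} (hvN : v ∉ N)
    (hv : p v = x ᵥ* of fun i : N => p i) (hF : ∀ e ∈ F, v ∉ e) (hm : m ∈ motions χ p D F)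
    (hobs : extensionObstruction (of fun i j : N => strain p s(i.1, j.1) m)
      (fun i => speed (χ i) m.2) (speed (χ v) m.2) x ≠ 0) {c : N}
    (hLI : LinearIndepOn ℝ p (insert v (N.erase c) : Finset V)) :
    ∃ m' ∈ motions χ p D (cone v (N.erase c) F), strain p s(v, c.1) m' ≠ 0 := by
  obtain ⟨y, hy⟩ := exists_dotProduct_eq hLI fun w =>
    if w = v then -speed (χ v) m.2 else -speed (χ v) m.2 - p v ⬝ᵥ m.1 w + p w ⬝ᵥ m.1 w
  have hyv : p v ⬝ᵥ y + speed (χ v) m.2 = 0 := by simp [hy v (by simp)]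
  have hm' := update_mem_motions (fun _ _ => rfl) hF hm hyv
  obtain ⟨hmS, hmF⟩ := mem_motions.1 hm'
  have hstrain : ∀ w ∈ N, strain p s(v, w) (Function.update m.1 v y, m.2) =
      (p v - p w) ⬝ᵥ (y - m.1 w) := fun w hw => by
    simp [strain_mk, ne_of_mem_of_not_mem hw hvN]
  have hzero : ∀ w ∈ N.erase c, strain p s(v, w) (Function.update m.1 v y, m.2) = 0 := by
    intro w hw
    have hyw := hy w (by simp [Finset.mem_erase.1 hw])
    rw [if_neg (ne_of_mem_of_not_mem (Finset.mem_of_mem_erase hw) hvN)] at hyw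
    rw [hstrain w (Finset.mem_of_mem_erase hw)]
    simp only [sub_dotProduct, dotProduct_sub]
    linarith
  refine ⟨_, mem_motions.2 ⟨hmS, fun e he => ?_⟩, fun h0 => ?_⟩
  · rcases mem_cone.1 he with ⟨w, hw, rfl⟩ | he
    · exact hzero w hw
    · exact hmF e he
  · simp only [strain_mk] at hobs
    refine hobs (extensionObstruction_eq_zero (a' := of fun i : N => m.1 i) hv hyv
      (fun i => (mem_sphereMotions.1 (mem_motions.1 hm).1).1 i) fun i => ?_)
    refine (hstrain i i.2).symm.trans ?_
    by_cases hi : i = c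
    · rwa [hi]
    · exact hzero i (Finset.mem_erase.2 ⟨fun h => hi (Subtype.ext h), i.2⟩)

variable [Finite V] [Finite C]

theorem rk_cone_of_linearIndepOn (hvN : v ∉ N) (hN : LinearIndepOn ℝ p (insert v N : Finset V))
    (hF : ∀ e ∈ F, v ∉ e) : rk χ p D (cone v N F) = rk χ p D F + N.card := by
  induction N using Finset.induction_on with
  | empty => simp [cone]
  | insert c N hc ih =>
    rw [Finset.mem_insert, not_or] at hvN
    have hmono : insert v N ⊆ insert v (insert c N) :=
      Finset.insert_subset_insert _ (Finset.subset_insert _ _)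
    obtain ⟨y, hy⟩ := exists_dotProduct_eq hN fun w => if w = c then 1 else 0
    have hyv : p v ⬝ᵥ y = 0 := by simpa [hvN.1] using hy v (by simp)
    have hyc : p c ⬝ᵥ y = 1 := by simpa using hy c (by simp)
    have hyN : ∀ w ∈ N, p w ⬝ᵥ y = 0 := fun w hw => by
      simpa [ne_of_mem_of_not_mem hw hc] using hy w (by simp [hw])
    have hm := update_mem_motions (χ := χ) (D := D) (m := 0) (fun _ _ => rfl) hF (zero_mem _)
      (by simpa using hyv)
    obtain ⟨hmS, hmF⟩ := mem_motions.1 hm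
    have hstrain : ∀ w ≠ v, strain p s(v, w) (Function.update 0 v y, (0 : C → ℝ)) =
        -(p w ⬝ᵥ y) := fun w hw => by simp [strain_mk, hw, hyv]
    rw [cone_insert, rk, rankOn_insert_of_ne_zero (mem_motions.2 ⟨hmS, fun e he => ?_⟩)
      ((hstrain c (Ne.symm hvN.1)).trans_ne (by simp [hyc])), ← rk,
      ih hvN.2 (hN.mono (Finset.coe_subset.2 hmono)), Finset.card_insert_of_notMem hc, add_assoc]
    rcases mem_cone.1 he with ⟨w, hw, rfl⟩ | he
    · exact (hstrain w (ne_of_mem_of_not_mem hw hvN.2)).trans (by rw [hyN w hw, neg_zero])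
    · exact hmF e he

theorem rk_cone_of_extensionObstruction_ne_zero {m : Velocity n V C} {x : N → ℝ} (hvN : v ∉ N)
    (hN : LinearIndepOn ℝ p N) (hv : p v = x ᵥ* of fun i : N => p i) (hv0 : p v ≠ 0)
    (hF : ∀ e ∈ F, v ∉ e) (hm : m ∈ motions χ p D F)
    (hobs : extensionObstruction (of fun i j : N => strain p s(i.1, j.1) m)
      (fun i => speed (χ i) m.2) (speed (χ v) m.2) x ≠ 0) :
    rk χ p D (cone v N F) = rk χ p D F + N.card := by
  obtain ⟨c, hc⟩ : ∃ c, x c ≠ 0 := by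
    by_contra! h
    exact hv0 (by rw [hv, funext h]; exact zero_vecMul _)
  have hLI := linearIndepOn_insert_erase hN hv hc
  obtain ⟨m', hm', hne⟩ := exists_mem_motions_cone_erase hvN hv hF hm hobs hLI
  rw [← Finset.insert_erase c.2, cone_insert, rk, rankOn_insert_of_ne_zero hm' hne, ← rk,
    rk_cone_of_linearIndepOn (fun h => hvN (Finset.mem_of_mem_erase h)) hLI hF,
    Finset.card_insert_of_notMem (Finset.notMem_erase _ _), add_assoc]

end Extension

section MotionMatrix

variable {n : ℕ} {V C : Type*} {χ : V → Option C} {D : Finset C} {F : Finset (Sym2 V)}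

/-- Infinitesimal motions as vectors indexed by the columns of the rigidity matrix. -/
def velocityEquiv (n : ℕ) (V C : Type*) : ((V × Fin n) ⊕ C → ℝ) ≃ₗ[ℝ] Velocity n V C :=
  (LinearEquiv.sumArrowLequivProdArrow (V × Fin n) C ℝ ℝ).trans
    ((LinearEquiv.curry ℝ ℝ V (Fin n)).prodCongr (.refl ℝ _))

/-- The rigidity matrix of the edge set `F`, with an additional row for each colour outside `D`
that keeps its radius constant. -/
def motionMatrix [DecidableEq V] [DecidableEq C] {R : Type*} [CommRing R] (χ : V → Option C)
    (p : V → Fin n → R) (D : Finset C) (F : Finset (Sym2 V)) :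
    Matrix (F ⊕ (V ⊕ {c // c ∉ D})) ((V × Fin n) ⊕ C) R
  | Sum.inl e, Sum.inl (w, i) =>
      if h : w ∈ (e : Sym2 V) then p w i - p (Sym2.Mem.other h) i else 0
  | Sum.inl _, Sum.inr _ => 0
  | Sum.inr (Sum.inl v), Sum.inl (w, i) => if w = v then p v i else 0
  | Sum.inr (Sum.inl v), Sum.inr c => if χ v = some c then 1 else 0
  | Sum.inr (Sum.inr _), Sum.inl _ => 0
  | Sum.inr (Sum.inr d), Sum.inr c => if c = d.1 then 1 else 0

variable [DecidableEq V] [DecidableEq C]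

theorem motionMatrix_map {R S : Type*} [CommRing R] [CommRing S] (f : R →+* S)
    (p : V → Fin n → R) :
    (motionMatrix χ p D F).map f = motionMatrix χ (fun v i => f (p v i)) D F := by
  ext (e | v | d) (⟨w, i⟩ | c) <;> simp only [map_apply, motionMatrix] <;>
    (try split_ifs) <;> simp

theorem dite_mem_sub_other {R : Type*} [CommRing R] (p : V → R) (u w x : V) :
    (if h : x ∈ s(u, w) then p x - p (Sym2.Mem.other h) else 0) =
      (p u - p w) * ((if x = u then 1 else 0) - if x = w then 1 else 0) := by
  by_cases h : x ∈ s(u, w)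
  · rw [dif_pos h]
    have hother := Sym2.other_spec h
    generalize Sym2.Mem.other h = y at hother
    rcases Sym2.eq_iff.1 hother with ⟨rfl, rfl⟩ | ⟨rfl, rfl⟩ <;> rcases eq_or_ne x y with rfl | hxy
    all_goals simp_all
  · rw [dif_neg h]
    rw [Sym2.mem_iff, not_or] at h
    simp [h]

variable [Fintype V] [Fintype C] {p : V → Fin n → ℝ}

theorem motionMatrix_mulVec_edge (m : (V × Fin n) ⊕ C → ℝ) (e : F) :
    (motionMatrix χ p D F *ᵥ m) (Sum.inl e) = strain p e (velocityEquiv n V C m) := by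
  obtain ⟨⟨u, w⟩, he⟩ := e
  change _ = (p u - p w) ⬝ᵥ (fun i => m (Sum.inl (u, i)) - m (Sum.inl (w, i)))
  simp only [mulVec, dotProduct, Fintype.sum_sum_type, motionMatrix, zero_mul,
    Finset.sum_const_zero, add_zero, Fintype.sum_prod_type, Pi.sub_apply]
  rw [Finset.sum_comm]
  refine Finset.sum_congr rfl fun i _ => ?_
  trans ∑ x, (p u i - p w i) * ((if x = u then 1 else 0) - if x = w then 1 else 0) *
    m (Sum.inl (x, i))
  · exact Finset.sum_congr rfl fun x _ =>
      congrArg (· * _) (dite_mem_sub_other (fun v => p v i) u w x)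
  · simp [mul_sub, sub_mul, Finset.sum_sub_distrib]

theorem motionMatrix_mulVec_vertex (m : (V × Fin n) ⊕ C → ℝ) (v : V) :
    (motionMatrix χ p D F *ᵥ m) (Sum.inr (Sum.inl v)) =
      p v ⬝ᵥ (velocityEquiv n V C m).1 v + speed (χ v) (velocityEquiv n V C m).2 := by
  have hspeed : speed (χ v) (velocityEquiv n V C m).2 =
      ∑ c, (if χ v = some c then 1 else 0) * m (Sum.inr c) := by
    cases χ v <;> simp [velocityEquiv]
  rw [hspeed]
  simp only [mulVec, dotProduct, Fintype.sum_sum_type, motionMatrix, Fintype.sum_prod_type]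
  congr 1
  rw [Finset.sum_comm]
  simp [velocityEquiv]

theorem motionMatrix_mulVec_eq_zero {m : (V × Fin n) ⊕ C → ℝ} :
    motionMatrix χ p D F *ᵥ m = 0 ↔ velocityEquiv n V C m ∈ motions χ p D F := by
  have hcolour : ∀ d : {c // c ∉ D}, (motionMatrix χ p D F *ᵥ m) (Sum.inr (Sum.inr d)) =
      (velocityEquiv n V C m).2 d := fun d => by
    simp [mulVec, dotProduct, motionMatrix, velocityEquiv]
  rw [mem_motions, mem_sphereMotions, _root_.funext_iff]
  simp only [Sum.forall, motionMatrix_mulVec_edge, motionMatrix_mulVec_vertex, hcolour,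
    Pi.zero_apply, Subtype.forall]
  tauto

theorem rank_motionMatrix (hp : ∀ v, p v ≠ 0) :
    (motionMatrix χ p D F).rank + D.card = Fintype.card V + Fintype.card C + rk χ p D F := by
  have hker : LinearMap.ker (motionMatrix χ p D F).mulVecLin =
      (motions χ p D F).comap (velocityEquiv n V C : _ →ₗ[ℝ] _) := by
    ext m
    exact motionMatrix_mulVec_eq_zero
  have hdim := LinearMap.finrank_range_add_finrank_ker (motionMatrix χ p D F).mulVecLin
  rw [hker, ((velocityEquiv n V C).ofSubmodule' _).finrank_eq, ← Matrix.rank,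
    finrank_fintype_fun_eq_card, Fintype.card_sum, Fintype.card_prod, Fintype.card_fin,
    mul_comm] at hdim
  have hrk := rk_add_finrank (χ := χ) (D := D) (F := F) hp
  rw [Nat.card_eq_fintype_card] at hrk
  omega

theorem rank_motionMatrix_eq_card_iff (hp : ∀ v, p v ≠ 0) :
    (motionMatrix χ p D F).rank = Fintype.card (F ⊕ (V ⊕ {c // c ∉ D})) ↔
      rk χ p D F = F.card := by
  have hrank := rank_motionMatrix (χ := χ) (D := D) (F := F) hp
  have hD := Finset.card_le_univ D
  rw [Fintype.card_sum, Fintype.card_sum, Fintype.card_coe, Fintype.card_subtype_compl,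
    Fintype.card_coe]
  omega

end MotionMatrix

section Genericity

theorem rank_eq_card_iff_det_mul_transpose_ne_zero {ι κ : Type*} [Fintype ι] [DecidableEq ι]
    [Fintype κ] {A : Matrix ι κ ℝ} : A.rank = Fintype.card ι ↔ (A * Aᵀ).det ≠ 0 := by
  rw [← rank_self_mul_transpose]
  refine ⟨fun h => ?_, rank_of_det_ne_zero⟩
  have hrange : LinearMap.range (A * Aᵀ).mulVecLin = ⊤ :=
    Submodule.eq_top_of_finrank_eq (by rwa [finrank_fintype_fun_eq_card])
  exact ((isUnit_iff_isUnit_det _).1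
    (mulVec_surjective_iff_isUnit.1 (LinearMap.range_eq_top.1 hrange))).ne_zero

variable {d : ℕ} {V C : Type*} {χ : V → Option C} {D : Finset C} {F : Finset (Sym2 V)}
  {q : V → Fin (d + 1) → ℝ} {s : C → ℝ}

/-- The positions `q` and the radii `s` form a point of the variety defined by the sphere
polynomials. -/
def OnSpheres (χ : V → Option C) (q : V → Fin (d + 1) → ℝ) (s : C → ℝ) : Prop :=
  ∀ v, q v ⬝ᵥ q v = radius s (χ v) ^ 2

/-- Evaluation of polynomials at the positions `q` and the radii `s`. -/
def evalAt (q : V → Fin (d + 1) → ℝ) (s : C → ℝ) :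
    MvPolynomial ((V × Fin (d + 1)) ⊕ C) ℚ →ₐ[ℚ] ℝ :=
  aeval (Sum.elim (fun x => q x.1 x.2) s)

/-- The positions of a framework as coordinate vectors. -/
def Framework.pos (P : Framework d χ) (v : V) : Fin (d + 1) → ℝ := fun i => P.p v i

variable {P : Framework d χ}

theorem Framework.onSpheres_pos : OnSpheres χ P.pos P.r := fun v => by
  have h := P.mem_sphere v
  rw [mem_sphere_zero_iff_norm] at h
  rw [← h, EuclideanSpace.real_norm_sq_eq]
  exact Finset.sum_congr rfl fun i _ => (sq _).symm

theorem Framework.radius_pos (o : Option C) : 0 < radius P.r o := by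
  cases o
  · exact one_pos
  · exact P.r_pos _

theorem OnSpheres.ne_zero (hq : OnSpheres χ q P.r) (v : V) : q v ≠ 0 := fun h => by
  have hv := hq v
  rw [h, zero_dotProduct] at hv
  exact (pow_pos (P.radius_pos (χ v)) 2).ne hv

theorem Framework.pos_ne_zero (v : V) : P.pos v ≠ 0 := P.onSpheres_pos.ne_zero v

theorem Framework.IsGeneric.evalAt_ne_zero (hP : P.IsGeneric) (hq : OnSpheres χ q s)
    {f : MvPolynomial ((V × Fin (d + 1)) ⊕ C) ℚ} (hf : evalAt q s f ≠ 0) :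
    evalAt P.pos P.r f ≠ 0 := by
  refine fun h => hf ?_
  suffices hle : Ideal.span (Set.range (spherePoly (d := d) χ)) ≤ RingHom.ker (evalAt q s) from
    hle (hP f h)
  rw [Ideal.span_le]
  rintro _ ⟨v, rfl⟩
  have hradius : evalAt q s (radiusSqPoly V d (χ v)) = radius s (χ v) ^ 2 := by
    rcases χ v with _ | c <;> simp [evalAt, radiusSqPoly, radius]
  have hsum : evalAt q s (∑ i, X (Sum.inl (v, i)) ^ 2) = q v ⬝ᵥ q v := by
    simp [evalAt, dotProduct, sq]
  rw [SetLike.mem_coe, RingHom.mem_ker, spherePoly, map_sub, hradius, hsum, hq v, sub_self]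

theorem Framework.IsGeneric.rank_map_evalAt_eq_card (hP : P.IsGeneric) (hq : OnSpheres χ q s)
    {ι κ : Type*} [Fintype ι] [Fintype κ]
    {A : Matrix ι κ (MvPolynomial ((V × Fin (d + 1)) ⊕ C) ℚ)}
    (hA : (A.map (evalAt q s)).rank = Fintype.card ι) :
    (A.map (evalAt P.pos P.r)).rank = Fintype.card ι := by
  classical
  have hdet : ∀ f : MvPolynomial ((V × Fin (d + 1)) ⊕ C) ℚ →ₐ[ℚ] ℝ,
      (A.map f * (A.map f)ᵀ).det = f (A * Aᵀ).det := fun f => by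
    rw [← transpose_map, ← Matrix.map_mul, AlgHom.map_det]
    rfl
  rw [rank_eq_card_iff_det_mul_transpose_ne_zero, hdet] at hA ⊢
  exact hP.evalAt_ne_zero hq hA

theorem Framework.IsGeneric.rk_eq_card [Finite V] [Finite C] (hP : P.IsGeneric)
    (hq : OnSpheres χ q P.r) (hF : rk χ q D F = F.card) : rk χ P.pos D F = F.card := by
  classical
  cases nonempty_fintype V
  cases nonempty_fintype C
  let x (v : V) (i : Fin (d + 1)) : MvPolynomial ((V × Fin (d + 1)) ⊕ C) ℚ := X (Sum.inl (v, i))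
  have hmap : ∀ q : V → Fin (d + 1) → ℝ,
      (motionMatrix χ x D F).map (evalAt q P.r) = motionMatrix χ q D F := fun q => by
    refine (motionMatrix_map (evalAt q P.r).toRingHom x).trans (congrArg (motionMatrix χ · D F) ?_)
    ext v i
    simp [x, evalAt]
  rw [← rank_motionMatrix_eq_card_iff hq.ne_zero, ← hmap] at hF
  rw [← rank_motionMatrix_eq_card_iff P.pos_ne_zero, ← hmap]
  exact hP.rank_map_evalAt_eq_card hq hF

theorem onSpheres_smul_single (s : C → ℝ) (f : V → Fin (d + 1)) :
    OnSpheres χ (fun v => radius s (χ v) • Pi.single (f v) 1) s := fun v => by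
  simp [sq]

theorem Framework.IsGeneric.linearIndepOn_pos (hP : P.IsGeneric) {N : Finset V}
    (hN : N.card ≤ d + 1) : LinearIndepOn ℝ P.pos N := by
  obtain ⟨g⟩ : Nonempty (N ↪ Fin (d + 1)) := Function.Embedding.nonempty_of_card_le (by simpa)
  let f : V → Fin (d + 1) := Function.extend Subtype.val g 0
  let A : Matrix N (Fin (d + 1)) (MvPolynomial ((V × Fin (d + 1)) ⊕ C) ℚ) :=
    of fun v i => X (Sum.inl (v.1, i))
  have hA : ∀ q : V → Fin (d + 1) → ℝ, A.map (evalAt q P.r) = of fun v : N => q v := fun q => by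
    ext v i
    simp [A, evalAt]
  have hsingle : LinearIndependent ℝ fun v : N =>
      radius P.r (χ v) • (Pi.single (f v) 1 : Fin (d + 1) → ℝ) := by
    have hf : ∀ v : N, f v = g v := Subtype.val_injective.extend_apply _ _
    simp only [hf]
    exact ((Pi.linearIndependent_single_one _ ℝ).comp g g.injective).units_smul
      fun v => Units.mk0 _ (P.radius_pos (χ v)).ne'
  have hrank := hP.rank_map_evalAt_eq_card (onSpheres_smul_single P.r f) (A := A)
    (by rw [hA]; exact hsingle.rank_matrix)
  rw [hA, rank_eq_finrank_span_row] at hrank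
  exact linearIndependent_iff_card_eq_finrank_span.2 hrank.symm

theorem Framework.IsGeneric.radius_injective (hP : P.IsGeneric) :
    Function.Injective (radius P.r) := by
  classical
  intro o o' h
  let f (o : Option C) : MvPolynomial ((V × Fin (d + 1)) ⊕ C) ℚ := o.elim 1 fun c => X (Sum.inr c)
  have hf : ∀ (q : V → Fin (d + 1) → ℝ) s o, evalAt q s (f o) = radius s o := fun q s o => by
    cases o <;> simp [f, evalAt, radius]
  by_contra hne
  obtain ⟨s, hs⟩ : ∃ s : C → ℝ, radius s o ≠ radius s o' := by
    refine ⟨fun c => if o' = some c then 3 else 2, fun h => hne ?_⟩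
    cases o <;> cases o' <;> simp_all [radius]
  refine hP.evalAt_ne_zero (onSpheres_smul_single (χ := χ) s 0) (f := f o - f o') ?_ ?_
  · rwa [map_sub, hf, hf, sub_ne_zero]
  · rw [map_sub, hf, hf, h, sub_self]

end Genericity

section VertexAddition

variable {d : ℕ} {V C : Type*} {χ : V → Option C} {P : Framework d χ} {D : Finset C}
  {F : Finset (Sym2 V)} {N : Finset V} {v : V}

theorem Framework.IsGeneric.exists_extensionObstruction_ne_zero (hP : P.IsGeneric)
    (hN : N.Nonempty) (hNd : N.card ≤ d + 1) {m : Velocity (d + 1) V C}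
    (hm : ¬(speed (χ v) m.2 = 0 ∧ (∀ w ∈ N, speed (χ w) m.2 = 0) ∧
      ∀ e ∈ N.sym2, strain P.pos e m = 0)) :
    ∃ x, (x ᵥ* of fun i : N => P.pos i) ⬝ᵥ (x ᵥ* of fun i : N => P.pos i) =
        radius P.r (χ v) ^ 2 ∧
      extensionObstruction (of fun i j : N => strain P.pos s(i.1, j.1) m)
        (fun i => speed (χ i) m.2) (speed (χ v) m.2) x ≠ 0 := by
  have := hN.to_subtype
  refine ExpandingSpheres.exists_extensionObstruction_ne_zero (hP.linearIndepOn_pos hNd)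
    (pow_pos (P.radius_pos _) 2) (fun i hi => ?_) ?_ (fun i => ?_) fun h => hm ⟨h.1, ?_, ?_⟩
  · have hradius := (P.onSpheres_pos i).symm.trans hi
    rw [pow_left_inj₀ (P.radius_pos _).le (P.radius_pos _).le two_ne_zero] at hradius
    rw [hP.radius_injective hradius]
  · ext i j
    rw [transpose_apply, of_apply, of_apply, Sym2.eq_swap]
  · rw [of_apply, strain_mk, sub_self, zero_dotProduct]
  · exact fun w hw => congrFun h.2.1 ⟨w, hw⟩
  · intro e he
    induction e with | _ a b => ?_
    obtain ⟨ha, hb⟩ := Finset.mk_mem_sym2_iff.1 he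
    exact congrFun₂ h.2.2 ⟨a, ha⟩ ⟨b, hb⟩

variable [Finite V] [Finite C] [DecidableEq V]

theorem Framework.IsGeneric.rk_cone (hP : P.IsGeneric) (hvN : v ∉ N) (hN : N.card ≤ d)
    (hF : ∀ e ∈ F, v ∉ e) : rk χ P.pos D (cone v N F) = rk χ P.pos D F + N.card :=
  rk_cone_of_linearIndepOn hvN
    (hP.linearIndepOn_pos (by rw [Finset.card_insert_of_notMem hvN]; omega)) hF

theorem Framework.IsGeneric.rk_cone_eq_card (hP : P.IsGeneric) (hvN : v ∉ N) (hN : N.Nonempty)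
    (hNd : N.card ≤ d + 1) (hF : ∀ e ∈ F, v ∉ e) (hcard : rk χ P.pos D F = F.card)
    {m : Velocity (d + 1) V C} (hmF : m ∈ motions χ P.pos D F)
    (hm : ¬(speed (χ v) m.2 = 0 ∧ (∀ w ∈ N, speed (χ w) m.2 = 0) ∧
      ∀ e ∈ N.sym2, strain P.pos e m = 0)) :
    rk χ P.pos D (cone v N F) = (cone v N F).card := by
  obtain ⟨x, hx, hobs⟩ := hP.exists_extensionObstruction_ne_zero hN hNd hm
  let q := Function.update P.pos v (x ᵥ* of fun i : N => P.pos i)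
  have hqv : q v = x ᵥ* of fun i : N => P.pos i := Function.update_self _ _ _
  have hqP : ∀ w ≠ v, P.pos w = q w := fun w hw => (Function.update_of_ne hw _ _).symm
  have hqN : ∀ w ∈ N, P.pos w = q w := fun w hw => hqP w (ne_of_mem_of_not_mem hw hvN)
  have hq : OnSpheres χ q P.r := fun w => by
    rcases eq_or_ne w v with rfl | hw
    · rw [hqv, hx]
    · rw [← hqP w hw, P.onSpheres_pos]
  obtain ⟨m', hm', hmv, hm2⟩ := exists_mem_motions_of_eqOn hqP (hq.ne_zero v) hF hmF
  have hstrain : ∀ i j : N, strain P.pos s(i.1, j.1) m = strain q s(i.1, j.1) m' := fun i j => by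
    rw [strain_mk, strain_mk, hqN i i.2, hqN j j.2, hmv i (ne_of_mem_of_not_mem i.2 hvN),
      hmv j (ne_of_mem_of_not_mem j.2 hvN)]
  simp only [hstrain, ← hm2] at hobs
  have hqrows : (of fun i : N => P.pos i) = of fun i : N => q i := by
    ext i k
    rw [of_apply, of_apply, hqN i i.2]
  have hLI : LinearIndepOn ℝ q N := (linearIndepOn_congr hqN).1 (hP.linearIndepOn_pos hNd)
  have hrk := rk_cone_of_extensionObstruction_ne_zero hvN hLI (hqrows ▸ hqv) (hq.ne_zero v) hF hm'
    hobs
  have hle := rk_le_rk_of_eqOn (χ := χ) (D := D) hqP (hq.ne_zero v) hF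
  have hle' : rk χ q D F ≤ F.card := rankOn_le_card
  have hcone := card_cone (N := N) hF
  exact hP.rk_eq_card hq (by omega)

end VertexAddition

section EdgeSets

variable {V : Type*} {F : Finset (Sym2 V)} {U U' W : Finset V} {v : V} {e : Sym2 V}

theorem two_le_card_of_mem_sym2 (he : ¬ e.IsDiag) (heU : e ∈ U.sym2) : 2 ≤ U.card := by
  classical
  rw [← Sym2.card_toFinset_of_not_isDiag e he]
  exact Finset.card_le_card fun v hv => Finset.mem_sym2_iff.1 heU v (Sym2.mem_toFinset.1 hv)

variable [DecidableEq V]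

theorem notMem_of_mem_sym2_erase (he : e ∈ (W.erase v).sym2) : v ∉ e := fun hv =>
  Finset.notMem_erase v W (Finset.mem_sym2_iff.1 he v hv)

theorem disjoint_inter_sym2 (hnd : ∀ e ∈ F, ¬ e.IsDiag) (h : (U ∩ U').card ≤ 1) :
    Disjoint (F ∩ U.sym2) (F ∩ U'.sym2) := by
  refine Finset.disjoint_left.2 fun e he he' => ?_
  rw [Finset.mem_inter, Finset.mem_sym2_iff] at he he'
  have := two_le_card_of_mem_sym2 (hnd e he.1)
    (Finset.mem_sym2_iff.2 fun v hv => Finset.mem_inter.2 ⟨he.2 v hv, he'.2 v hv⟩)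
  omega

theorem card_inter_sym2_add_card_inter_sym2_le :
    (F ∩ U.sym2).card + (F ∩ U'.sym2).card ≤
      (F ∩ (U ∪ U').sym2).card + (F ∩ (U ∩ U').sym2).card := by
  have hunion : F ∩ U.sym2 ∪ F ∩ U'.sym2 ⊆ F ∩ (U ∪ U').sym2 := Finset.union_subset
    (Finset.inter_subset_inter_left (Finset.sym2_mono Finset.subset_union_left))
    (Finset.inter_subset_inter_left (Finset.sym2_mono Finset.subset_union_right))
  have hinter : (F ∩ U.sym2) ∩ (F ∩ U'.sym2) ⊆ F ∩ (U ∩ U').sym2 := fun e he => by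
    simp only [Finset.mem_inter, Finset.mem_sym2_iff] at he ⊢
    exact ⟨he.1.1, fun v hv => ⟨he.1.2 v hv, he.2.2 v hv⟩⟩
  rw [← Finset.card_union_add_card_inter]
  exact Nat.add_le_add (Finset.card_le_card hunion) (Finset.card_le_card hinter)

theorem sum_card_filter_mem (hnd : ∀ e ∈ F, ¬ e.IsDiag) (hF : F ⊆ W.sym2) :
    ∑ v ∈ W, (F.filter (v ∈ ·)).card = 2 * F.card := by
  have hends : ∀ e ∈ F, (W.filter (· ∈ e)).card = 2 := fun e he => by
    rw [← Sym2.card_toFinset_of_not_isDiag e (hnd e he)]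
    congr 1
    ext v
    rw [Finset.mem_filter, Sym2.mem_toFinset, and_iff_right_iff_imp]
    exact Finset.mem_sym2_iff.1 (hF he) v
  calc ∑ v ∈ W, (F.filter (v ∈ ·)).card
      = ∑ e ∈ F, (W.filter (· ∈ e)).card :=
        Finset.sum_card_bipartiteAbove_eq_sum_card_bipartiteBelow _
    _ = 2 * F.card := by rw [Finset.sum_congr rfl hends, Finset.sum_const, smul_eq_mul, mul_comm]

theorem exists_eq_cone_of_card_lt (hnd : ∀ e ∈ F, ¬ e.IsDiag) (hF : F ⊆ W.sym2)
    (hcard : F.card < 2 * W.card) :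
    ∃ v ∈ W, ∃ N ⊆ W.erase v, ∃ F₀ ⊆ (W.erase v).sym2, N.card ≤ 3 ∧ F = cone v N F₀ := by
  obtain ⟨v, hv, hdeg⟩ : ∃ v ∈ W, (F.filter (v ∈ ·)).card < 4 := by
    refine Finset.exists_lt_of_sum_lt ?_
    rw [sum_card_filter_mem hnd hF, Finset.sum_const, smul_eq_mul]
    omega
  let N : Finset V := (W.erase v).filter (s(v, ·) ∈ F)
  refine ⟨v, hv, N, Finset.filter_subset _ _, F ∩ (W.erase v).sym2, Finset.inter_subset_right,
    ?_, ?_⟩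
  · refine Nat.le_of_lt_succ (lt_of_le_of_lt (Finset.card_le_card_of_injOn (s(v, ·)) ?_ ?_) hdeg)
    · exact fun w hw => Finset.mem_filter.2 ⟨(Finset.mem_filter.1 hw).2, Sym2.mem_mk_left v w⟩
    · exact fun _ _ _ _ => Sym2.congr_right.1
  · ext e
    rw [mem_cone, Finset.mem_inter, Finset.mem_sym2_iff]
    constructor
    · intro he
      have heW := Finset.mem_sym2_iff.1 (hF he)
      by_cases hve : v ∈ e
      · obtain ⟨w, rfl⟩ := hve
        have hwv : w ≠ v := fun h => hnd _ he (Sym2.mk_isDiag_iff.2 h.symm)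
        exact .inl ⟨w, Finset.mem_filter.2
          ⟨Finset.mem_erase.2 ⟨hwv, heW w (Sym2.mem_mk_right v w)⟩, he⟩, rfl⟩
      · exact .inr ⟨he, fun w hw => Finset.mem_erase.2 ⟨fun h => hve (h ▸ hw), heW w hw⟩⟩
    · rintro (⟨w, hw, rfl⟩ | he)
      exacts [(Finset.mem_filter.1 hw).2, he.1]

end EdgeSets

section Sparsity

variable {V : Type*} [DecidableEq V] {F F' : Finset (Sym2 V)} {N U U' : Finset V} {v : V}
  {e : Sym2 V}

/-- Laman's sparsity condition, the independence condition for bar-joint frameworks in the plane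
and on the sphere. Loops have to be excluded separately. -/
def IsSparse (F : Finset (Sym2 V)) : Prop :=
  ∀ U : Finset V, 2 ≤ U.card → (F ∩ U.sym2).card + 3 ≤ 2 * U.card

/-- A set of vertices is tight if Laman's sparsity condition holds for it with equality. In a sparse
graph, the tight sets induce the rigid subgraphs. -/
def IsTight (F : Finset (Sym2 V)) (U : Finset V) : Prop :=
  2 ≤ U.card ∧ (F ∩ U.sym2).card + 3 = 2 * U.card

theorem isSparse_empty : IsSparse (∅ : Finset (Sym2 V)) := fun U hU => by
  rw [Finset.empty_inter, Finset.card_empty]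
  omega

theorem IsSparse.subset (h : IsSparse F') (hF : F ⊆ F') : IsSparse F := fun U hU =>
  le_trans (by gcongr) (h U hU)

theorem IsSparse.isTight_union (h : IsSparse F) (hU : IsTight F U) (hU' : IsTight F U')
    (hinter : 2 ≤ (U ∩ U').card) : IsTight F (U ∪ U') := by
  have hle : 2 ≤ (U ∪ U').card := hU.1.trans (Finset.card_le_card Finset.subset_union_left)
  have hcard := Finset.card_union_add_card_inter U U'
  have hsuper := card_inter_sym2_add_card_inter_sym2_le (F := F) (U := U) (U' := U')
  have hsparse_union := h _ hle
  have hsparse_inter := h _ hinter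
  have heq := hU.2
  have heq' := hU'.2
  exact ⟨hle, by omega⟩

theorem IsSparse.exists_mem_of_isTight (h : IsSparse F) (hnd : ∀ e ∈ F, ¬ e.IsDiag)
    (hU : IsTight F U) (hv : v ∈ U) : ∃ e ∈ F, v ∈ e := by
  by_contra! hisolated
  have herase : F ∩ U.sym2 ⊆ F ∩ (U.erase v).sym2 := fun e he => by
    simp only [Finset.mem_inter, Finset.mem_sym2_iff] at he ⊢
    exact ⟨he.1, fun w hw => Finset.mem_erase.2 ⟨fun h => hisolated e he.1 (h ▸ hw), he.2 w hw⟩⟩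
  have hcard := Finset.card_le_card herase
  have hcard_erase := Finset.card_erase_add_one hv
  obtain ⟨htwo, heq⟩ := hU
  have hpos : 0 < (F ∩ (U.erase v).sym2).card := by omega
  obtain ⟨e, he⟩ := Finset.card_pos.1 hpos
  rw [Finset.mem_inter] at he
  have := h _ (two_le_card_of_mem_sym2 (hnd e he.1) he.2)
  omega

theorem IsSparse.exists_isTight (h : IsSparse F) (he : ¬ e.IsDiag)
    (hmax : e ∉ F → ¬ IsSparse (insert e F)) : ∃ U, IsTight F U ∧ e ∈ U.sym2 := by
  by_cases heF : e ∈ F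
  · have hcard := Sym2.card_toFinset_of_not_isDiag e he
    have hmem : e ∈ e.toFinset.sym2 := Finset.mem_sym2_iff.2 fun v hv => Sym2.mem_toFinset.2 hv
    have hsparse := h e.toFinset hcard.ge
    have hpos : 0 < (F ∩ e.toFinset.sym2).card :=
      Finset.card_pos.2 ⟨e, Finset.mem_inter.2 ⟨heF, hmem⟩⟩
    exact ⟨e.toFinset, ⟨hcard.ge, by omega⟩, hmem⟩
  · have hviolated := hmax heF
    rw [IsSparse] at hviolated
    push Not at hviolated
    obtain ⟨U, hU, hlt⟩ := hviolated
    have hsparse := h U hU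
    by_cases heU : e ∈ U.sym2
    · rw [Finset.insert_inter_of_mem heU] at hlt
      have := Finset.card_insert_le e (F ∩ U.sym2)
      exact ⟨U, ⟨hU, by omega⟩, heU⟩
    · rw [Finset.insert_inter_of_notMem heU] at hlt
      omega

theorem IsSparse.exists_isTight_of_triangle (h : IsSparse F) (hnd : ∀ e ∈ F, ¬ e.IsDiag) {a b c : V}
    {U₁ U₂ U₃ : Finset V} (h₁ : IsTight F U₁) (h₂ : IsTight F U₂) (h₃ : IsTight F U₃)
    (hac : a ≠ c) (hab₁ : s(a, b) ∈ U₁.sym2) (hbc₂ : s(b, c) ∈ U₂.sym2)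
    (hac₃ : s(a, c) ∈ U₃.sym2) : ∃ U, IsTight F U ∧ {a, b, c} ⊆ U := by
  simp only [Finset.mk_mem_sym2_iff] at hab₁ hbc₂ hac₃
  by_cases h₁₂ : 2 ≤ (U₁ ∩ U₂).card
  · exact ⟨_, h.isTight_union h₁ h₂ h₁₂, by simp [Finset.insert_subset_iff, *]⟩
  by_cases h₁₃ : 2 ≤ (U₁ ∩ U₃).card
  · exact ⟨_, h.isTight_union h₁ h₃ h₁₃, by simp [Finset.insert_subset_iff, *]⟩
  by_cases h₂₃ : 2 ≤ (U₂ ∩ U₃).card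
  · exact ⟨_, h.isTight_union h₂ h₃ h₂₃, by simp [Finset.insert_subset_iff, *]⟩
  refine ⟨U₁ ∪ U₂ ∪ U₃, ?_, by simp [Finset.insert_subset_iff, *]⟩
  have hedges : (F ∩ U₁.sym2).card + (F ∩ U₂.sym2).card + (F ∩ U₃.sym2).card ≤
      (F ∩ (U₁ ∪ U₂ ∪ U₃).sym2).card := by
    rw [← Finset.card_union_of_disjoint (disjoint_inter_sym2 hnd (by omega)),
      ← Finset.card_union_of_disjoint (Finset.disjoint_union_left.2
        ⟨disjoint_inter_sym2 hnd (by omega), disjoint_inter_sym2 hnd (by omega)⟩)]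
    refine Finset.card_le_card (Finset.union_subset (Finset.union_subset ?_ ?_) ?_) <;>
      refine Finset.inter_subset_inter_left (Finset.sym2_mono fun x hx => ?_) <;> simp [hx]
  have hunion := Finset.card_union_add_card_inter U₁ U₂
  have hunion' := Finset.card_union_add_card_inter (U₁ ∪ U₂) U₃
  have hb : 0 < (U₁ ∩ U₂).card := Finset.card_pos.2 ⟨b, by simp [*]⟩
  have hpair : 2 ≤ ((U₁ ∪ U₂) ∩ U₃).card := by
    rw [← Finset.card_pair hac]
    exact Finset.card_le_card (by simp [Finset.insert_subset_iff, *])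
  have htwo : 2 ≤ (U₁ ∪ U₂ ∪ U₃).card := h₁.1.trans
    (Finset.card_le_card (Finset.subset_union_left.trans Finset.subset_union_left))
  have hsparse := h _ htwo
  have heq₁ := h₁.2
  have heq₂ := h₂.2
  have heq₃ := h₃.2
  exact ⟨htwo, by omega⟩

theorem IsTight.not_isSparse_cone (hU : IsTight F U) (hNU : N ⊆ U) (hN : 3 ≤ N.card)
    (hF : ∀ e ∈ F, v ∉ e) (hv : v ∉ U) : ¬ IsSparse (cone v N F) := fun h => by
  have hsub : cone v N (F ∩ U.sym2) ⊆ cone v N F ∩ (insert v U).sym2 := fun e he => by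
    rw [Finset.mem_inter]
    rcases mem_cone.1 he with ⟨w, hw, rfl⟩ | he
    · exact ⟨mem_cone.2 (.inl ⟨w, hw, rfl⟩), by simp [hNU hw]⟩
    · rw [Finset.mem_inter] at he
      exact ⟨mem_cone.2 (.inr he.1), Finset.sym2_mono (Finset.subset_insert v U) he.2⟩
  have hcard := Finset.card_le_card hsub
  rw [card_cone fun e he => hF e (Finset.mem_inter.1 he).1] at hcard
  have hinsert := Finset.card_insert_of_notMem hv
  have hsparse := h (insert v U) (by have := hU.1; omega)
  have := hU.2
  omega

theorem IsSparse.not_isSparse_cone (h : IsSparse F) (hnd : ∀ e ∈ F, ¬ e.IsDiag)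
    (hF : ∀ e ∈ F, v ∉ e) (hN : N.card = 3)
    (htight : ∀ e ∈ N.sym2, ¬ e.IsDiag → ∃ U, IsTight F U ∧ e ∈ U.sym2) :
    ¬ IsSparse (cone v N F) := by
  obtain ⟨a, b, c, hab, hac, hbc, rfl⟩ := Finset.card_eq_three.1 hN
  obtain ⟨U₁, h₁, hab₁⟩ := htight s(a, b) (by simp) (by simpa)
  obtain ⟨U₂, h₂, hbc₂⟩ := htight s(b, c) (by simp) (by simpa)
  obtain ⟨U₃, h₃, hac₃⟩ := htight s(a, c) (by simp) (by simpa)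
  obtain ⟨U, hU, hNU⟩ := h.exists_isTight_of_triangle hnd h₁ h₂ h₃ hac hab₁ hbc₂ hac₃
  refine hU.not_isSparse_cone hNU hN.ge hF fun hv => ?_
  obtain ⟨e, he, hve⟩ := h.exists_mem_of_isTight hnd hU hv
  exact hF e he hve

theorem exists_isSparse_forall_not_isSparse_insert (E : Finset (Sym2 V)) :
    ∃ F ⊆ E, IsSparse F ∧ ∀ e ∈ E, e ∉ F → ¬ IsSparse (insert e F) := by
  have hfin : {F | F ⊆ E ∧ IsSparse F}.Finite :=
    E.powerset.finite_toSet.subset fun F hF => Finset.mem_coe.2 (Finset.mem_powerset.2 hF.1)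
  obtain ⟨F, hF⟩ := hfin.exists_maximal ⟨∅, Finset.empty_subset E, isSparse_empty⟩
  refine ⟨F, hF.prop.1, hF.prop.2, fun e he heF hsp => heF ?_⟩
  exact hF.le_of_ge ⟨Finset.insert_subset he hF.prop.1, hsp⟩ (Finset.subset_insert e F)
    (Finset.mem_insert_self e F)

theorem IsSparse.isOneThin {𝒳 : Finset (Finset V)} (h : IsSparse F)
    (h𝒳 : ∀ U ∈ 𝒳, Maximal (IsTight F) U) : IsOneThin 𝒳 := fun Y hY Z hZ hne => by
  by_contra! hinter
  have hunion := h.isTight_union (h𝒳 Y hY).prop (h𝒳 Z hZ).prop hinter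
  exact hne (((h𝒳 Y hY).eq_of_le hunion Finset.subset_union_left).trans
    ((h𝒳 Z hZ).eq_of_le hunion Finset.subset_union_right).symm)

theorem sum_le_card_of_forall_isTight {𝒳 : Finset (Finset V)} (hnd : ∀ e ∈ F, ¬ e.IsDiag)
    (h𝒳 : ∀ U ∈ 𝒳, IsTight F U) (hthin : IsOneThin 𝒳) :
    ∑ Y ∈ 𝒳, (2 * (Y.card : ℤ) - 3) ≤ F.card := by
  calc ∑ Y ∈ 𝒳, (2 * (Y.card : ℤ) - 3)
      = ∑ Y ∈ 𝒳, ((F ∩ Y.sym2).card : ℤ) := Finset.sum_congr rfl fun Y hY => by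
        have := (h𝒳 Y hY).2
        omega
    _ = ((𝒳.biUnion fun Y => F ∩ Y.sym2).card : ℤ) := by
        rw [Finset.card_biUnion fun Y hY Z hZ hne => disjoint_inter_sym2 hnd (hthin Y hY Z hZ hne),
          Nat.cast_sum]
    _ ≤ F.card := by
        gcongr
        exact Finset.biUnion_subset.2 fun Y _ => Finset.inter_subset_left

end Sparsity

section Laman

variable {V C : Type*} [Finite V] [Finite C] [DecidableEq V] {χ : V → Option C}
  {P : Framework 2 χ}

/-- Laman's theorem. -/
theorem Framework.IsGeneric.rk_empty_eq_card_of_isSparse (hP : P.IsGeneric) (W : Finset V)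
    {F : Finset (Sym2 V)} (hnd : ∀ e ∈ F, ¬ e.IsDiag) (hW : F ⊆ W.sym2) (hF : IsSparse F) :
    rk χ P.pos ∅ F = F.card := by
  induction W using Finset.strongInduction generalizing F with | H W ih => ?_
  rcases F.eq_empty_or_nonempty with rfl | ⟨e, he⟩
  · exact rankOn_empty
  have hWF := hF W (two_le_card_of_mem_sym2 (hnd e he) (hW he))
  rw [Finset.inter_eq_left.2 hW] at hWF
  obtain ⟨v, hv, N, hN, F₀, hF₀, hdeg, rfl⟩ := exists_eq_cone_of_card_lt hnd hW (by omega)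
  replace ih {F} := ih (F := F) _ (Finset.erase_ssubset hv)
  have hvN : v ∉ N := fun h => Finset.notMem_erase v W (hN h)
  have hvF₀ : ∀ e ∈ F₀, v ∉ e := fun e he => notMem_of_mem_sym2_erase (hF₀ he)
  have hsub : F₀ ⊆ cone v N F₀ := fun e he => mem_cone.2 (.inr he)
  have hnd₀ : ∀ e ∈ F₀, ¬ e.IsDiag := fun e he => hnd e (hsub he)
  have hsp₀ := hF.subset hsub
  have hrk := ih hnd₀ hF₀ hsp₀
  rcases Nat.le_or_eq_of_le_succ hdeg with hN2 | hN3
  · rw [hP.rk_cone hvN hN2 hvF₀, hrk, card_cone hvF₀]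
  by_contra hdep
  refine hsp₀.not_isSparse_cone hnd₀ hvF₀ hN3 (fun e he hed => ?_) hF
  refine hsp₀.exists_isTight hed fun heF hsp => ?_
  have hstrain : ∀ m ∈ motions χ P.pos ∅ F₀, strain P.pos e m = 0 := fun m hm => by
    by_contra hne
    exact hdep (hP.rk_cone_eq_card hvN (Finset.card_pos.1 (by omega)) hdeg hvF₀ hrk hm
      fun h => hne (h.2.2 e he))
  have hcard := ih (Finset.forall_mem_insert _ _ _ |>.2 ⟨hed, hnd₀⟩)
    (Finset.insert_subset (Finset.sym2_mono hN he) hF₀) hsp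
  rw [rk, rankOn_insert_of_forall_eq_zero hstrain, ← rk, hrk,
    Finset.card_insert_of_notMem heF] at hcard
  omega

/-- The rank formula of Lovász and Yemini. -/
theorem Framework.IsGeneric.exists_isOneThin_sum_le_rk_empty (hP : P.IsGeneric)
    {E : Finset (Sym2 V)} (hnd : ∀ e ∈ E, ¬ e.IsDiag) :
    ∃ 𝒳 : Finset (Finset V), (∀ Y ∈ 𝒳, 2 ≤ Y.card ∧ ∀ v ∈ Y, ∃ e ∈ E, v ∈ e) ∧
      (∀ e ∈ E, ∃ Y ∈ 𝒳, e ∈ Y.sym2) ∧ IsOneThin 𝒳 ∧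
      ∑ Y ∈ 𝒳, (2 * (Y.card : ℤ) - 3) ≤ rk χ P.pos ∅ E := by
  classical
  cases nonempty_fintype V
  obtain ⟨F, hFE, hF, hmax⟩ := exists_isSparse_forall_not_isSparse_insert E
  have hndF : ∀ e ∈ F, ¬ e.IsDiag := fun e he => hnd e (hFE he)
  let 𝒳 : Finset (Finset V) := Finset.univ.filter (Maximal (IsTight F))
  have h𝒳 : ∀ U ∈ 𝒳, Maximal (IsTight F) U := fun U hU => (Finset.mem_filter.1 hU).2
  refine ⟨𝒳, fun Y hY => ⟨(h𝒳 Y hY).prop.1, fun v hv => ?_⟩, fun e he => ?_, hF.isOneThin h𝒳, ?_⟩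
  · obtain ⟨e, he, hve⟩ := hF.exists_mem_of_isTight hndF (h𝒳 Y hY).prop hv
    exact ⟨e, hFE he, hve⟩
  · obtain ⟨U, hU, heU⟩ := hF.exists_isTight (hnd e he) (hmax e he)
    obtain ⟨Y, hUY, hY⟩ := (Set.toFinite {U | IsTight F U}).exists_le_maximal hU
    exact ⟨Y, Finset.mem_filter.2 ⟨Finset.mem_univ Y, hY⟩, Finset.sym2_mono hUY heU⟩
  · have hrk : rk χ P.pos ∅ F = F.card := hP.rk_empty_eq_card_of_isSparse Finset.univ hndF
      (by rw [Finset.sym2_univ]; exact Finset.subset_univ F) hF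
    have hmono : rk χ P.pos ∅ F ≤ rk χ P.pos ∅ E := rankOn_mono hFE
    refine (sum_le_card_of_forall_isTight hndF (fun Y hY => (h𝒳 Y hY).prop)
      (hF.isOneThin h𝒳)).trans ?_
    exact_mod_cast hrk ▸ hmono

end Laman

section Colours

variable {V C : Type*} {χ : V → Option C} {D : Finset C} {S T F K : Finset (Sym2 V)}

theorem coloursAt_empty : coloursAt χ D ∅ = ∅ := by
  ext c
  simp [mem_coloursAt]

theorem coloursAt_mono (h : S ⊆ T) : coloursAt χ D S ⊆ coloursAt χ D T := fun c hc => by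
  obtain ⟨hcD, e, he, hec⟩ := mem_coloursAt.1 hc
  exact mem_coloursAt.2 ⟨hcD, e, h he, hec⟩

theorem coloursAt_sdiff [DecidableEq C] {D' : Finset C} :
    coloursAt χ (D \ D') T = coloursAt χ D T \ D' := by
  ext c
  simp only [mem_coloursAt, Finset.mem_sdiff]
  tauto

theorem coloursAt_union [DecidableEq V] [DecidableEq C] :
    coloursAt χ D (S ∪ T) = coloursAt χ D S ∪ coloursAt χ D T := by
  ext c
  simp only [mem_coloursAt, Finset.mem_union, or_and_right, exists_or, and_or_left]

theorem card_coloursAt_union_add_card_coloursAt_inter_le [DecidableEq V] :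
    (coloursAt χ D (S ∪ T)).card + (coloursAt χ D (S ∩ T)).card ≤
      (coloursAt χ D S).card + (coloursAt χ D T).card := by
  classical
  rw [← Finset.card_union_add_card_inter (coloursAt χ D S), coloursAt_union]
  gcongr
  exact Finset.subset_inter (coloursAt_mono Finset.inter_subset_left)
    (coloursAt_mono Finset.inter_subset_right)

variable [Finite V] [Finite C] {n : ℕ} {p : V → Fin n → ℝ}

theorem rk_sdiff_union_add_card [DecidableEq V] [DecidableEq C] {D' : Finset C}
    (hp : ∀ v, p v ≠ 0) (hD' : D' ⊆ D) (hspeed : ∀ m ∈ motions χ p D F, ∀ c ∈ D', m.2 c = 0)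
    (hstrain : ∀ m ∈ motions χ p D F, ∀ e ∈ K, strain p e m = 0) :
    rk χ p (D \ D') (F ∪ K) + D'.card = rk χ p D F := by
  have hmotions : motions χ p (D \ D') (F ∪ K) = motions χ p D F := by
    refine le_antisymm ((motions_mono Finset.sdiff_subset).trans
      (jointKer_anti Finset.subset_union_left)) fun m hm => ?_
    obtain ⟨hmS, hmF⟩ := mem_motions.1 hm
    obtain ⟨hsphere, hD⟩ := mem_sphereMotions.1 hmS
    refine mem_motions.2 ⟨mem_sphereMotions.2 ⟨hsphere, fun c hc => ?_⟩, fun e he => ?_⟩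
    · by_cases hcD' : c ∈ D'
      · exact hspeed m hm c hcD'
      · exact hD c fun hcD => hc (Finset.mem_sdiff.2 ⟨hcD, hcD'⟩)
    · exact (Finset.mem_union.1 he).elim (hmF e) (hstrain m hm e)
  have hrk := rk_add_finrank (χ := χ) (D := D) (F := F) hp
  have hrk' := rk_add_finrank (χ := χ) (D := D \ D') (F := F ∪ K) hp
  rw [hmotions] at hrk'
  have := Finset.card_sdiff_add_card_eq_card hD'
  omega

/-- By Edmonds' theorem, a description of the independent sets gives a formula for the rank. -/
theorem exists_superset_card_sdiff_add_le [DecidableEq V] {E : Finset (Sym2 V)} (hKE : K ⊆ E)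
    (hK : coloursAt χ D K = ∅)
    (hindep : ∀ F ⊆ E, (∀ T ⊆ F, T.card ≤ rk χ p ∅ T + (coloursAt χ D T).card) →
      rk χ p D F = F.card) :
    ∃ T ⊆ E, K ⊆ T ∧ (E \ T).card + (rk χ p ∅ T + (coloursAt χ D T).card) ≤ rk χ p D E := by
  classical
  obtain ⟨F, hFE, hF, T, hTE, hle⟩ := exists_indep_card_sdiff_add_le
    (f := fun T => rk χ p ∅ T + (coloursAt χ D T).card)
    (fun S T h => Nat.add_le_add (rankOn_mono h) (Finset.card_le_card (coloursAt_mono h)))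
    (fun S T => by
      have hrk := rankOn_union_add_rankOn_inter (S := sphereMotions χ p ∅) (φ := strain p) S T
      have hcol := card_coloursAt_union_add_card_coloursAt_inter_le (χ := χ) (D := D) (S := S)
        (T := T)
      simp only [rk]
      omega)
    (by simp [rk, rankOn_empty, coloursAt_empty]) E
  have hFrk : F.card ≤ rk χ p D E := hindep F hFE hF ▸ rankOn_mono hFE
  refine ⟨T ∪ K, Finset.union_subset hTE hKE, Finset.subset_union_right, ?_⟩
  rw [coloursAt_union, hK, Finset.union_empty]
  have hrk : rk χ p ∅ (T ∪ K) ≤ rk χ p ∅ T + (K \ T).card := by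
    rw [← Finset.union_sdiff_self_eq_union]
    exact rankOn_union_le_add_card _ _
  have hcard : (E \ (T ∪ K)).card + (K \ T).card = (E \ T).card := by
    have hsdiff : E \ (T ∪ K) = (E \ T) \ (K \ T) := by
      ext e
      simp only [Finset.mem_sdiff, Finset.mem_union]
      tauto
    rw [hsdiff, Finset.card_sdiff_add_card_eq_card (Finset.sdiff_subset_sdiff hKE subset_rfl)]
  omega

end Colours

section Clique

variable {V C : Type*} {χ : V → Option C} {P : Framework 2 χ} {N : Finset V} {v w : V}

theorem Framework.IsGeneric.cross_pos_ne_zero (hP : P.IsGeneric) {a b : V} (hab : a ≠ b) :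
    P.pos a ⨯₃ P.pos b ≠ 0 := by
  classical
  have hpair := hP.linearIndepOn_pos (N := {a, b}) (by rw [Finset.card_pair hab]; omega)
  rw [Finset.coe_pair, LinearIndepOn.pair_iff _ hab] at hpair
  rwa [crossProduct_ne_zero_iff_linearIndependent, LinearIndependent.pair_iff]

variable [DecidableEq V]

/-- The edges of the complete graph on `N`. -/
def clique (N : Finset V) : Finset (Sym2 V) := N.sym2.filter (¬ ·.IsDiag)

theorem mem_clique {e : Sym2 V} : e ∈ clique N ↔ e ∈ N.sym2 ∧ ¬ e.IsDiag := Finset.mem_filter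

theorem cone_clique_subset {M : Finset V} (hw : w ∉ N) (hM : M ⊆ N) :
    cone w M (clique N) ⊆ clique (insert w N) := fun e he => by
  rw [mem_clique]
  rcases mem_cone.1 he with ⟨x, hx, rfl⟩ | he
  · have hxw : w ≠ x := fun h => hw (h ▸ hM hx)
    exact ⟨by simp [hM hx], by simpa⟩
  · exact ⟨Finset.sym2_mono (Finset.subset_insert w N) (mem_clique.1 he).1, (mem_clique.1 he).2⟩

variable [Finite V] [Finite C]

theorem Framework.IsGeneric.two_mul_card_le_rk_clique_add_three (hP : P.IsGeneric) (N : Finset V) :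
    2 * N.card ≤ rk χ P.pos ∅ (clique N) + 3 := by
  induction N using Finset.induction_on with
  | empty => simp
  | insert w N hw ih =>
    obtain ⟨M, hMN, hM⟩ := Finset.exists_subset_card_eq (min_le_right 2 N.card)
    have hcone : rk χ P.pos ∅ (cone w M (clique N)) = rk χ P.pos ∅ (clique N) + M.card :=
      hP.rk_cone (fun h => hw (hMN h)) (hM ▸ min_le_left _ _) fun e he hwe =>
        hw (Finset.mem_sym2_iff.1 (mem_clique.1 he).1 w hwe)
    have hmono : rk χ P.pos ∅ (cone w M (clique N)) ≤ rk χ P.pos ∅ (clique (insert w N)) :=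
      rankOn_mono (cone_clique_subset hw hMN)
    rw [Finset.card_insert_of_notMem hw]
    omega

/-- Both the clique on `N` and the clique on `insert v N` are rigid on the sphere. -/
theorem Framework.IsGeneric.rk_empty_cone_le (hP : P.IsGeneric) (hv : v ∉ N) (hN : N.Nonempty)
    {T : Finset (Sym2 V)} (hT : clique N ⊆ T) :
    rk χ P.pos ∅ (cone v N T) ≤ rk χ P.pos ∅ T + 2 := by
  obtain ⟨w, hw⟩ := hN
  let K := cone v N (clique N)
  have hK : rk χ P.pos ∅ K + 3 ≤ 2 * (insert v N).card :=
    rk_empty_add_three_le P.pos_ne_zero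
      (((cone_clique_subset hv (subset_refl N)).trans (Finset.filter_subset _ _)))
      (Finset.mem_insert_self v N) (Finset.mem_insert_of_mem hw)
      (hP.cross_pos_ne_zero fun h => hv (h ▸ hw))
  rw [Finset.card_insert_of_notMem hv] at hK
  have hclique := hP.two_mul_card_le_rk_clique_add_three N
  have hsub : rk χ P.pos ∅ (T ∪ K) + rk χ P.pos ∅ (T ∩ K) ≤ rk χ P.pos ∅ T + rk χ P.pos ∅ K :=
    rankOn_union_add_rankOn_inter _ _
  have hinter : rk χ P.pos ∅ (clique N) ≤ rk χ P.pos ∅ (T ∩ K) :=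
    rankOn_mono (Finset.subset_inter hT Finset.subset_union_right)
  have hunion : rk χ P.pos ∅ (cone v N T) ≤ rk χ P.pos ∅ (T ∪ K) := rankOn_mono fun e he => by
    rw [Finset.mem_union, mem_cone]
    exact (mem_cone.1 he).elim (fun h => .inr (.inl h)) .inl
  omega

end Clique

section DegreeThree

variable {V C : Type*} [DecidableEq V] {χ : V → Option C} {D : Finset C} {N : Finset V} {v : V}
  {F : Finset (Sym2 V)}

theorem speed_eq_zero_of_mem_coloursAt_cone {c : C} {σ : C → ℝ} (hv : speed (χ v) σ = 0)
    (hN : ∀ w ∈ N, speed (χ w) σ = 0) (hc : c ∈ coloursAt χ D (cone v N ∅)) : σ c = 0 := by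
  obtain ⟨-, e, he, x, hx, hxc⟩ := mem_coloursAt.1 hc
  obtain ⟨w, hw, rfl⟩ := (mem_cone.1 he).resolve_right (Finset.notMem_empty e)
  rw [← speed_some c σ, ← hxc]
  rcases Sym2.mem_iff.1 hx with rfl | rfl
  exacts [hv, hN _ hw]

theorem coloursAt_clique_subset :
    coloursAt χ D (clique N) ⊆ coloursAt χ D (cone v N ∅) := fun c hc => by
  obtain ⟨hcD, e, he, x, hx, hxc⟩ := mem_coloursAt.1 hc
  have hxN := Finset.mem_sym2_iff.1 (mem_clique.1 he).1 x hx
  exact mem_coloursAt.2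
    ⟨hcD, s(v, x), mem_cone.2 (.inl ⟨x, hxN, rfl⟩), x, Sym2.mem_mk_right v x, hxc⟩

theorem coloursAt_cone [DecidableEq C] :
    coloursAt χ D (cone v N F) = coloursAt χ D (cone v N ∅) ∪ coloursAt χ D F := by
  rw [← coloursAt_union, cone, cone, Finset.union_empty]

variable [Finite V] [Finite C] {P : Framework 2 χ}

theorem Framework.IsGeneric.card_cone_le (hP : P.IsGeneric) (hvN : v ∉ N) (hN : N.Nonempty)
    (hindep : ∀ T ⊆ cone v N F, T.card ≤ rk χ P.pos ∅ T + (coloursAt χ D T).card)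
    {T : Finset (Sym2 V)} (hT : clique N ⊆ T) :
    (cone v N F).card ≤
      (F \ T).card + (rk χ P.pos ∅ T + 2 + (coloursAt χ D (cone v N T)).card) := by
  have hle := hindep (cone v N F ∩ cone v N T) Finset.inter_subset_left
  have hrk : rk χ P.pos ∅ (cone v N F ∩ cone v N T) ≤ rk χ P.pos ∅ (cone v N T) :=
    rankOn_mono Finset.inter_subset_right
  have hcol : (coloursAt χ D (cone v N F ∩ cone v N T)).card ≤ (coloursAt χ D (cone v N T)).card :=
    Finset.card_le_card (coloursAt_mono Finset.inter_subset_right)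
  have hsdiff : (cone v N F \ cone v N T).card ≤ (F \ T).card :=
    Finset.card_le_card fun e he => by
      simp only [Finset.mem_sdiff, mem_cone, not_or] at he ⊢
      exact ⟨he.1.resolve_left he.2.1, he.2.2⟩
  have hcard := Finset.card_sdiff_add_card_inter (cone v N F) (cone v N T)
  have hcone := hP.rk_empty_cone_le hvN hN hT
  omega

/-- If `F` with at most three edges at `v` were dependent, then the neighbours of `v` would be
rigidly linked by the other edges, on spheres of constant radius. -/
theorem Framework.IsGeneric.rk_cone_eq_card_of_forall_card_le (hP : P.IsGeneric) (hvN : v ∉ N)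
    (hN : N.card = 3) (hvF : ∀ e ∈ F, v ∉ e) (hF : rk χ P.pos D F = F.card)
    (hformula : ∀ D' ⊆ D, coloursAt χ D' (clique N) = ∅ → ∃ T ⊆ F ∪ clique N, clique N ⊆ T ∧
      ((F ∪ clique N) \ T).card + (rk χ P.pos ∅ T + (coloursAt χ D' T).card) ≤
        rk χ P.pos D' (F ∪ clique N))
    (hindep : ∀ T ⊆ cone v N F, T.card ≤ rk χ P.pos ∅ T + (coloursAt χ D T).card) :
    rk χ P.pos D (cone v N F) = (cone v N F).card := by
  classical
  by_contra hdep
  have hN0 : N.Nonempty := Finset.card_pos.1 (by omega)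
  have hrigid : ∀ m ∈ motions χ P.pos D F, speed (χ v) m.2 = 0 ∧ (∀ w ∈ N, speed (χ w) m.2 = 0) ∧
      ∀ e ∈ N.sym2, strain P.pos e m = 0 := fun m hm => by
    by_contra hne
    exact hdep (hP.rk_cone_eq_card hvN hN0 hN.le hvF hF hm hne)
  let D' := coloursAt χ D (cone v N ∅)
  have hD'D : D' ⊆ D := fun c hc => (mem_coloursAt.1 hc).1
  have hrk : rk χ P.pos (D \ D') (F ∪ clique N) + D'.card = rk χ P.pos D F :=
    rk_sdiff_union_add_card P.pos_ne_zero hD'D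
      (fun m hm c hc => speed_eq_zero_of_mem_coloursAt_cone (hrigid m hm).1 (hrigid m hm).2.1 hc)
      fun m hm e he => (hrigid m hm).2.2 e (mem_clique.1 he).1
  obtain ⟨T, -, hNT, hT⟩ := hformula (D \ D') Finset.sdiff_subset (by
    rw [coloursAt_sdiff, Finset.sdiff_eq_empty_iff_subset]
    exact coloursAt_clique_subset)
  have hcol : (coloursAt χ D (cone v N T)).card ≤ D'.card + (coloursAt χ (D \ D') T).card := by
    rw [coloursAt_cone, coloursAt_sdiff, ← Finset.union_sdiff_self_eq_union]
    exact Finset.card_union_le _ _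
  have hsdiff : (F \ T).card ≤ ((F ∪ clique N) \ T).card :=
    Finset.card_le_card (Finset.sdiff_subset_sdiff Finset.subset_union_left subset_rfl)
  have hcard := hP.card_cone_le hvN hN0 hindep hNT
  rw [card_cone hvF] at hcard
  omega

end DegreeThree

section Independence

variable {V C : Type*} [Finite V] [Finite C] {χ : V → Option C} {P : Framework 2 χ}
  {D : Finset C} {F : Finset (Sym2 V)}

theorem Framework.IsGeneric.rk_eq_card_of_forall_card_le (hP : P.IsGeneric)
    (hk : ∀ T, (coloursAt χ D T).card ≤ 2) (W : Finset V) (hnd : ∀ e ∈ F, ¬ e.IsDiag)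
    (hW : F ⊆ W.sym2)
    (hindep : ∀ T ⊆ F, T.card ≤ rk χ P.pos ∅ T + (coloursAt χ D T).card) :
    rk χ P.pos D F = F.card := by
  classical
  induction W using Finset.strongInduction generalizing D F with | H W ih => ?_
  rcases F.eq_empty_or_nonempty with rfl | ⟨e, he⟩
  · exact rankOn_empty
  have hlt : F.card < 2 * W.card := by
    obtain ⟨a, ha, b, hb, hab⟩ :=
      Finset.one_lt_card.1 (two_le_card_of_mem_sym2 (hnd e he) (hW he))
    have hrk := rk_empty_add_three_le (χ := χ) P.pos_ne_zero hW ha hb (hP.cross_pos_ne_zero hab)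
    have hF := hindep F subset_rfl
    have hkF := hk F
    omega
  obtain ⟨v, hv, N, hN, F₀, hF₀, hdeg, rfl⟩ := exists_eq_cone_of_card_lt hnd hW hlt
  replace ih {D F} := ih (D := D) (F := F) _ (Finset.erase_ssubset hv)
  have hvN : v ∉ N := fun h => Finset.notMem_erase v W (hN h)
  have hvF₀ : ∀ e ∈ F₀, v ∉ e := fun e he => notMem_of_mem_sym2_erase (hF₀ he)
  have hsub : F₀ ⊆ cone v N F₀ := Finset.subset_union_right
  have hnd₀ : ∀ e ∈ F₀, ¬ e.IsDiag := fun e he => hnd e (hsub he)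
  have hrk := ih hk hnd₀ hF₀ fun T hT => hindep T (hT.trans hsub)
  rcases Nat.le_or_eq_of_le_succ hdeg with hN2 | hN3
  · rw [hP.rk_cone hvN hN2 hvF₀, hrk, card_cone hvF₀]
  refine hP.rk_cone_eq_card_of_forall_card_le hvN hN3 hvF₀ hrk (fun D' hD' hcol => ?_) hindep
  refine exists_superset_card_sdiff_add_le Finset.subset_union_right hcol fun F hF hF' => ?_
  refine ih (fun T => ?_) (fun e he => ?_) (fun e he => ?_) hF'
  · refine (Finset.card_le_card fun c hc => ?_).trans (hk T)
    exact mem_coloursAt.2 ⟨hD' (mem_coloursAt.1 hc).1, (mem_coloursAt.1 hc).2⟩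
  · exact (Finset.mem_union.1 (hF he)).elim (hnd₀ e) fun he => (mem_clique.1 he).2
  · exact (Finset.mem_union.1 (hF he)).elim (fun he => hF₀ he) fun he =>
      Finset.sym2_mono hN (mem_clique.1 he).1

end Independence

section ColourCount

variable {V C : Type*} [Fintype C] [DecidableEq C] {χ : V → Option C} {E : Finset (Sym2 V)}
  {X : Finset V}

theorem card_coloursAt_le_numColours (h : E ⊆ X.sym2) :
    (coloursAt χ Finset.univ E).card ≤ numColours χ X := by
  refine Finset.card_le_card fun c hc => ?_
  obtain ⟨-, e, he, v, hv, hvc⟩ := mem_coloursAt.1 hc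
  exact Finset.mem_eraseNone.2 (Finset.mem_image.2 ⟨v, Finset.mem_sym2_iff.1 (h he) v hv, hvc⟩)

theorem numColours_le_card_coloursAt (h : ∀ v ∈ X, ∃ e ∈ E, v ∈ e) :
    numColours χ X ≤ (coloursAt χ Finset.univ E).card := by
  refine Finset.card_le_card fun c hc => ?_
  obtain ⟨v, hv, hvc⟩ := Finset.mem_image.1 (Finset.mem_eraseNone.1 hc)
  obtain ⟨e, he, hve⟩ := h v hv
  exact mem_coloursAt.2 ⟨Finset.mem_univ c, e, he, v, hve, hvc⟩

end ColourCount

section Covers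

theorem rank_rigidityMatrix {V C : Type*} [DecidableEq V] [DecidableEq C] [Fintype V] [Fintype C]
    {χ : V → Option C} {d : ℕ} (P : Framework d χ) (G : SimpleGraph V) [Fintype G.edgeSet] :
    (rigidityMatrix G χ P.p).rank = Fintype.card V + rk χ P.pos Finset.univ G.edgeFinset := by
  have : IsEmpty {c : C // c ∉ (Finset.univ : Finset C)} := ⟨fun c => c.2 (Finset.mem_univ _)⟩
  let rowEquiv : G.edgeSet ⊕ V ≃ G.edgeFinset ⊕ (V ⊕ {c : C // c ∉ (Finset.univ : Finset C)}) :=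
    (Equiv.subtypeEquivRight fun _ => G.mem_edgeFinset.symm).sumCongr (Equiv.sumEmpty V _).symm
  have hsubmatrix : rigidityMatrix G χ P.p =
      (motionMatrix χ P.pos Finset.univ G.edgeFinset).submatrix rowEquiv (Equiv.refl _) := by
    ext (e | v) (⟨w, i⟩ | c) <;> rfl
  have hrank := rank_motionMatrix (χ := χ) (D := Finset.univ) (F := G.edgeFinset) P.pos_ne_zero
  rw [Finset.card_univ] at hrank
  rw [hsubmatrix, rank_submatrix]
  omega

variable {V C : Type*} [DecidableEq V] {𝒳 𝒴 : Finset (Finset V)}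

theorem isCover_iff {G : SimpleGraph V} [Fintype G.edgeSet] :
    IsCover G 𝒳 ↔ (∀ Y ∈ 𝒳, 2 ≤ Y.card) ∧ G.edgeFinset ⊆ 𝒳.biUnion clique := by
  refine and_congr_right fun _ => ⟨fun h e he => ?_, fun h u w huw => ?_⟩
  · induction e with | _ u w => ?_
    have huw := G.mem_edgeFinset.1 he
    obtain ⟨Y, hY, hu, hw⟩ := h u w huw
    exact Finset.mem_biUnion.2 ⟨Y, hY, mem_clique.2
      ⟨Finset.mk_mem_sym2_iff.2 ⟨hu, hw⟩, G.not_isDiag_of_mem_edgeSet huw⟩⟩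
  · obtain ⟨Y, hY, he⟩ := Finset.mem_biUnion.1 (h (G.mem_edgeFinset.2 (G.mem_edgeSet.2 huw)))
    exact ⟨Y, hY, Finset.mk_mem_sym2_iff.1 (mem_clique.1 he).1⟩

theorem card_clique (N : Finset V) : (clique N).card = N.card.choose 2 := by
  rw [clique, Finset.sym2_eq_image, Sym2.filter_image_mk_not_isDiag, Sym2.card_image_offDiag]

theorem card_biUnion_clique_le (h : ∀ Y ∈ 𝒳, Y.card = 2) :
    ((𝒳.biUnion clique).card : ℤ) ≤ ∑ Y ∈ 𝒳, (2 * (Y.card : ℤ) - 3) := by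
  refine (Nat.cast_le.2 Finset.card_biUnion_le).trans ?_
  push_cast
  refine Finset.sum_le_sum fun Y hY => ?_
  rw [card_clique, h Y hY]
  norm_num

theorem IsOneThin.exists_isOneThin_union (h𝒴 : IsOneThin 𝒴) {E : Finset (Sym2 V)}
    (hnd : ∀ e ∈ E, ¬ e.IsDiag) :
    ∃ 𝒵, Disjoint 𝒴 𝒵 ∧ (∀ Z ∈ 𝒵, Z.card = 2) ∧ 𝒵.card ≤ E.card ∧
      E ⊆ (𝒴 ∪ 𝒵).biUnion clique ∧ IsOneThin (𝒴 ∪ 𝒵) := by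
  let 𝒵 := (E.image Sym2.toFinset).filter fun Z => ∀ Y ∈ 𝒴, ¬ Z ⊆ Y
  have h𝒵 : ∀ Z ∈ 𝒵, Z.card = 2 := fun Z hZ => by
    obtain ⟨e, he, rfl⟩ := Finset.mem_image.1 (Finset.mem_filter.1 hZ).1
    exact Sym2.card_toFinset_of_not_isDiag e (hnd e he)
  have hnsub : ∀ Z ∈ 𝒵, ∀ Y ∈ 𝒴 ∪ 𝒵, Z ≠ Y → ¬ Z ⊆ Y := fun Z hZ Y hY hne hZY => by
    rcases Finset.mem_union.1 hY with hY | hY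
    · exact (Finset.mem_filter.1 hZ).2 Y hY hZY
    · exact hne (Finset.eq_of_subset_of_card_le hZY (by rw [h𝒵 Z hZ, h𝒵 Y hY]))
  have hthin : ∀ Z ∈ 𝒵, ∀ Y ∈ 𝒴 ∪ 𝒵, Z ≠ Y → (Z ∩ Y).card ≤ 1 := fun Z hZ Y hY hne => by
    have hlt : (Z ∩ Y).card < Z.card := Finset.card_lt_card
      (Finset.inter_subset_left.ssubset_of_ne fun h =>
        hnsub Z hZ Y hY hne (Finset.inter_eq_left.1 h))
    have := h𝒵 Z hZ
    omega
  refine ⟨𝒵, Finset.disjoint_left.2 fun Y hY hZ => (Finset.mem_filter.1 hZ).2 Y hY subset_rfl, h𝒵,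
    (Finset.card_filter_le _ _).trans Finset.card_image_le, fun e he => ?_, fun Y hY Z hZ hne => ?_⟩
  · suffices ∃ Y ∈ 𝒴 ∪ 𝒵, e.toFinset ⊆ Y by
      obtain ⟨Y, hY, heY⟩ := this
      exact Finset.mem_biUnion.2 ⟨Y, hY, mem_clique.2 ⟨Finset.mem_sym2_iff.2 fun v hv =>
        heY (Sym2.mem_toFinset.2 hv), hnd e he⟩⟩
    by_cases h : ∃ Y ∈ 𝒴, e.toFinset ⊆ Y
    · exact h.imp fun Y hY => ⟨Finset.mem_union_left _ hY.1, hY.2⟩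
    · push Not at h
      exact ⟨e.toFinset, Finset.mem_union_right _
        (Finset.mem_filter.2 ⟨Finset.mem_image_of_mem _ he, h⟩), subset_rfl⟩
  · rcases Finset.mem_union.1 hY with hY' | hY'
    · rcases Finset.mem_union.1 hZ with hZ' | hZ'
      · exact h𝒴 Y hY' Z hZ' hne
      · exact Finset.inter_comm Y Z ▸ hthin Z hZ' Y hY hne.symm
    · exact hthin Y hY' Z hZ hne

variable {χ : V → Option C} {P : Framework 2 χ}

theorem Framework.IsGeneric.rk_empty_biUnion_clique_le [Finite V] [Finite C] (hP : P.IsGeneric)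
    (h : ∀ Y ∈ 𝒳, 2 ≤ Y.card) :
    (rk χ P.pos ∅ (𝒳.biUnion clique) : ℤ) ≤ ∑ Y ∈ 𝒳, (2 * (Y.card : ℤ) - 3) := by
  refine (Nat.cast_le.2 (rankOn_biUnion_le 𝒳 clique)).trans ?_
  push_cast
  refine Finset.sum_le_sum fun Y hY => ?_
  obtain ⟨a, ha, b, hb, hab⟩ := Finset.one_lt_card.1 (h Y hY)
  have hrk : rk χ P.pos ∅ (clique Y) + 3 ≤ 2 * Y.card := rk_empty_add_three_le P.pos_ne_zero
    (Finset.filter_subset _ _) ha hb (hP.cross_pos_ne_zero hab)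
  rw [rk] at hrk
  omega

variable [Finite V] [Fintype C] [DecidableEq C] {E : Finset (Sym2 V)} {X : Finset V}

theorem Framework.IsGeneric.rk_le_sum_add_numColours (hP : P.IsGeneric)
    (h𝒳 : ∀ Y ∈ 𝒳, 2 ≤ Y.card) (hE : E ⊆ 𝒳.biUnion clique) (hX : IsRestricted X 𝒳) :
    (rk χ P.pos Finset.univ E : ℤ) ≤ ∑ Y ∈ 𝒳, (2 * (Y.card : ℤ) - 3) + numColours χ X := by
  let 𝒴 := 𝒳.filter (3 ≤ ·.card)
  let 𝒵 := 𝒳.filter (¬ 3 ≤ ·.card)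
  have hunion : 𝒳.biUnion clique = 𝒴.biUnion clique ∪ 𝒵.biUnion clique := by
    rw [← Finset.union_biUnion, Finset.filter_union_filter_not_eq]
  have hrk : rk χ P.pos Finset.univ E ≤
      rk χ P.pos Finset.univ (𝒴.biUnion clique) + (𝒵.biUnion clique).card :=
    (rankOn_mono (hE.trans hunion.subset)).trans (rankOn_union_le_add_card _ _)
  have hrk𝒴 := rk_le_rk_empty_add_card_coloursAt (χ := χ) (D := Finset.univ)
    (F := 𝒴.biUnion clique) P.pos_ne_zero
  have hcol : (coloursAt χ Finset.univ (𝒴.biUnion clique)).card ≤ numColours χ X :=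
    card_coloursAt_le_numColours <| Finset.biUnion_subset.2 fun Y hY =>
      (Finset.filter_subset _ _).trans (Finset.sym2_mono
        (hX Y (Finset.mem_filter.1 hY).1 (Finset.mem_filter.1 hY).2))
  have h𝒴 := hP.rk_empty_biUnion_clique_le fun Y (hY : Y ∈ 𝒴) => h𝒳 Y (Finset.mem_filter.1 hY).1
  have h𝒵 : ((𝒵.biUnion clique).card : ℤ) ≤ ∑ Z ∈ 𝒵, (2 * (Z.card : ℤ) - 3) :=
    card_biUnion_clique_le fun Z hZ => by
      have hZ := Finset.mem_filter.1 hZ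
      have := h𝒳 Z hZ.1
      omega
  rw [← Finset.sum_filter_add_sum_filter_not 𝒳 (3 ≤ ·.card)]
  change _ ≤ ∑ Y ∈ 𝒴, _ + ∑ Z ∈ 𝒵, _ + _
  omega

theorem Framework.IsGeneric.exists_isOneThin_sum_add_numColours_le (hP : P.IsGeneric)
    (hk : ∀ T, (coloursAt χ Finset.univ T).card ≤ 2) (hnd : ∀ e ∈ E, ¬ e.IsDiag) :
    ∃ X 𝒳, (∀ Y ∈ 𝒳, 2 ≤ Y.card) ∧ E ⊆ 𝒳.biUnion clique ∧ IsOneThin 𝒳 ∧ IsRestricted X 𝒳 ∧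
      ∑ Y ∈ 𝒳, (2 * (Y.card : ℤ) - 3) + numColours χ X ≤ rk χ P.pos Finset.univ E := by
  classical
  cases nonempty_fintype V
  have huniv : ∀ F : Finset (Sym2 V), F ⊆ Finset.univ.sym2 := by simp
  obtain ⟨T, hTE, -, hT⟩ := exists_superset_card_sdiff_add_le (χ := χ) (D := Finset.univ)
    (p := P.pos) (Finset.empty_subset E) coloursAt_empty fun F hF =>
      hP.rk_eq_card_of_forall_card_le hk Finset.univ (fun e he => hnd e (hF he)) (huniv F)
  obtain ⟨𝒴, h𝒴, hT𝒴, hthin, hsum⟩ := hP.exists_isOneThin_sum_le_rk_empty fun e he => hnd e (hTE he)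
  obtain ⟨𝒵, hdisj, h𝒵, hcard, hET, hthin⟩ := hthin.exists_isOneThin_union
    (E := E \ T) fun e he => hnd e (Finset.mem_sdiff.1 he).1
  refine ⟨𝒴.biUnion id, 𝒴 ∪ 𝒵, fun Y hY => ?_, fun e he => ?_, hthin, fun Y hY hY3 => ?_, ?_⟩
  · exact (Finset.mem_union.1 hY).elim (fun hY => (h𝒴 Y hY).1) fun hY => (h𝒵 Y hY).ge
  · by_cases heT : e ∈ T
    · obtain ⟨Y, hY, heY⟩ := hT𝒴 e heT
      exact Finset.mem_biUnion.2 ⟨Y, Finset.mem_union_left _ hY, mem_clique.2 ⟨heY, hnd e he⟩⟩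
    · exact hET (Finset.mem_sdiff.2 ⟨he, heT⟩)
  · refine (Finset.mem_union.1 hY).elim (Finset.subset_biUnion_of_mem id) fun hY => ?_
    have := h𝒵 Y hY
    omega
  · have hsum𝒵 : ∑ Z ∈ 𝒵, (2 * (Z.card : ℤ) - 3) = 𝒵.card := by
      rw [Finset.sum_congr rfl fun Z hZ => show 2 * (Z.card : ℤ) - 3 = 1 by rw [h𝒵 Z hZ]; norm_num]
      simp
    have hcol := numColours_le_card_coloursAt (χ := χ) (X := 𝒴.biUnion id) fun v hv => by
      obtain ⟨Y, hY, hvY⟩ := Finset.mem_biUnion.1 hv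
      exact (h𝒴 Y hY).2 v hvY
    rw [Finset.sum_union hdisj, hsum𝒵]
    omega

end Covers

end ExpandingSpheres

end

theorem mainTheorem3 {V C : Type*} [Fintype V] [DecidableEq V] [Fintype C] [DecidableEq C]
    (G : SimpleGraph V) (χ : V → Option C)
    (hk : ExpandingSpheres.numColours χ Finset.univ ≤ 2)
    (P : ExpandingSpheres.Framework 2 χ) (hP : P.IsGeneric) :
    IsLeast
      {m : ℤ | ∃ (X : Finset V) (𝒳 : Finset (Finset V)),
        ExpandingSpheres.IsCover G 𝒳 ∧ ExpandingSpheres.IsOneThin 𝒳 ∧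
        ExpandingSpheres.IsRestricted X 𝒳 ∧
        m = (Fintype.card V : ℤ) + (∑ Y ∈ 𝒳, (2 * (Y.card : ℤ) - 3) +
          (ExpandingSpheres.numColours χ X : ℤ))}
      ((ExpandingSpheres.rigidityMatrix G χ P.p).rank : ℤ) := by
  classical
  rw [ExpandingSpheres.rank_rigidityMatrix, Nat.cast_add]
  simp only [ExpandingSpheres.isCover_iff]
  constructor
  · have hk' : ∀ T, (ExpandingSpheres.coloursAt χ Finset.univ T).card ≤ 2 := fun T =>
      (ExpandingSpheres.card_coloursAt_le_numColours (by simp)).trans hk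
    obtain ⟨X, 𝒳, h𝒳, hE, hthin, hX, hle⟩ := hP.exists_isOneThin_sum_add_numColours_le hk'
      fun e he => G.not_isDiag_of_mem_edgeSet (G.mem_edgeFinset.1 he)
    refine ⟨X, 𝒳, ⟨h𝒳, hE⟩, hthin, hX, ?_⟩
    rw [le_antisymm (hP.rk_le_sum_add_numColours h𝒳 hE hX) hle]
  · rintro m ⟨X, 𝒳, ⟨h𝒳, hE⟩, -, hX, rfl⟩
    exact Int.add_le_add_left (hP.rk_le_sum_add_numColours h𝒳 hE hX) _
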